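/- Let $\Omega$ be a finite alphabet with $|\Omega|=q\ge 2$, let $P:\Omega^k\to\{0,1\}$ be a satisfiable predicate and let $1<t\le k$ be an integer. A distribution on $\Omega^k$ is $t$-wise uniform if its marginal on every set of $t$ coordinates is uniform; let $$\delta_P(t)=\min_{\mu,\sigma} d_{\mathrm{TV}}(\mu,\sigma),$$ where $\mu$ ranges over the $t$-wise uniform distributions on $\Omega^k$ and $\sigma$ over the distributions supported on $P^{-1}(1)$. Fix a nonempty set $L$ of permutations of $\Omega$ (the "literals"; for $\Omega=\{0,1\}$ and $L=\{\mathrm{id},\mathrm{negation}\}$ one gets the Boolean problem $\mathrm{CSP}(P^{\pm})$). A constraint on variables $x_1,\dots,x_n$ consists of a scope $S=(S_1,\dots,S_k)$ of $k$ distinct variables and of $\ell\in L^k$, and an assignment $x\in\Omega^n$ satisfies it if $P(\ell_1(x_{S_1}),\dots,\ell_k(x_{S_k}))=1$. A random instance $\mathcal I$ consists of $m=\Delta n$ independent, uniformly random constraints. For variables $i\in[n]$ and letters $c\in\Omega$ let $X_{i,c}$ be indeterminates (standing for the indicator of $x_i=c$). For a real $D\ge0$, a degree-$D$ pseudoexpectation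 is a linear functional $\widetilde{\mathbf E}$ on real polynomials of degree at most $D$ in the $X_{i,c}$ with $\widetilde{\mathbf E}[1]=1$ and $\widetilde{\mathbf E}[p^2]\ge 0$ whenever $\deg p\le D/2$; here it is required to satisfy the identities $\sum_{c}X_{i,c}=1$ and $X_{i,c}^2=X_{i,c}$, where satisfying $p=0$ means $\widetilde{\mathbf E}[pr]=0$ for all polynomials $r$ with $\deg(pr)\le D$. Degree-$D$ SOS $\delta$-refutes $\mathcal I$ if $D\ge k$ and every such $\widetilde{\mathbf E}$ has $\widetilde{\mathbf E}[\text{fraction of satisfied constraints}]\le 1-\delta$, where a constraint $(S,\ell)$ contributes the polynomial $\sum_{a\in\Omega^k:\,P(\ell_1(a_1),\dots,\ell_k(a_k))=1}\ \prod_{j=1}^k X_{S_j,a_j}$. **Theorem.** There is a universal constant $C>0$ (independent of $\Omega,L,k,t,P,n,\Delta,\beta$) such that for all $n\ge1$, all $\Delta\ge 10$ with $m=\Delta n$ an integer, and all $0<\beta<1$, the following holds with $$\varepsilon=2^{\frac{\log n}{2\log\Delta}}\cdot\frac1{\sqrt n},\qquad D=\frac{\beta^{C/t}}{k\cdot 2^{Ck/t}}\cdot\frac{n}{\Delta^{2/(t-1)}\log\Delta}.$$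 Except with probability at most $\beta$ over the random instance $\mathcal I$ with $m$ constraints, degree-$D$ SOS fails to $(\delta_P(t)+\varepsilon)$-refute $\mathcal I$; that is, if $D\ge k$, there is a degree-$D$ pseudoexpectation, satisfying the identities above, for which the pseudo-expected fraction of satisfied constraints exceeds $1-\delta_P(t)-\varepsilon$. Moreover, for every $\Delta=\Delta(n)\ge10$ one has $\varepsilon=o(1)$ as $n\to\infty$, and $\varepsilon=O(1/\sqrt n)$ whenever $\Delta=n^{\Omega(1)}$. -/

import Mathlib

open MeasureTheory ProbabilityTheory Filter Topology Asymptotics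

noncomputable section

namespace RandomCSP

/-! ### Distance of a predicate from supporting a `t`-wise uniform distribution -/

/-- A distribution `μ` on `Ω^k` is `t`-wise uniform: its marginal on every set of `t`
coordinates is the uniform distribution. -/
def IsWiseUniform {Ω : Type*} [Fintype Ω] [DecidableEq Ω] {k : ℕ} (t : ℕ)
    (μ : (Fin k → Ω) → ℝ) : Prop :=
  ∀ T : Finset (Fin k), T.card = t → ∀ a : T → Ω,
    ∑ x : Fin k → Ω with (∀ i : T, x i = a i), μ x = ((Fintype.card Ω : ℝ) ^ t)⁻¹

/-- Total variation distance of two distributions on a finite set. -/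
def tvDist {α : Type*} [Fintype α] (μ σ : α → ℝ) : ℝ :=
  (1 / 2) * ∑ x, |μ x - σ x|

/-- `δ_P(t)`: the least total variation distance between a `t`-wise uniform distribution on `Ω^k`
and a distribution supported on satisfying assignments of `P`.  (For satisfiable `P` the infimum
is over the continuous image of a nonempty compact set, hence a minimum.) -/
def deltaP {Ω : Type*} [Fintype Ω] [DecidableEq Ω] {k : ℕ}
    (P : (Fin k → Ω) → Bool) (t : ℕ) : ℝ :=
  sInf {d : ℝ | ∃ μ ∈ stdSimplex ℝ (Fin k → Ω), ∃ σ ∈ stdSimplex ℝ (Fin k → Ω),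
    IsWiseUniform t μ ∧ (∀ x, P x = false → σ x = 0) ∧ d = tvDist μ σ}

/-! ### Random instances -/

/-- A constraint on `n` variables: an ordered scope of `k` distinct variables and a pattern of
literals, each of them a permutation of the alphabet taken from the set `L`.
For `Ω = Bool` and `L = Finset.univ` (identity and negation) these are the constraints of
`CSP(P^±)`; for larger alphabets `L` may be e.g. the shifts modulo `q` or all permutations. -/
abbrev Constraint (n k : ℕ) {Ω : Type*} (L : Finset (Equiv.Perm Ω)) : Type _ :=
  (Fin k ↪ Fin n) × (Fin k → L)

/-- An instance: a list of `m` constraints. -/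
def CSPInstance (n m k : ℕ) {Ω : Type*} (L : Finset (Equiv.Perm Ω)) : Type _ :=
  Fin m → Constraint n k L

instance (n m k : ℕ) {Ω : Type*} (L : Finset (Equiv.Perm Ω)) :
    MeasurableSpace (CSPInstance n m k L) := ⊤

/-- The law of a random instance: `m` independent, uniformly random constraints, i.e. the uniform
distribution on the finite set of all instances. -/
def randomInstance (n m k : ℕ) {Ω : Type*} (L : Finset (Equiv.Perm Ω)) :
    Measure (CSPInstance n m k L) :=
  uniformOn Set.univ

/-! ### Sum of squares -/

/-- The indicator polynomial of the event that a constraint is satisfied, in the indeterminates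
`X (i, c)` standing for the indicator of "variable `i` is assigned `c`". -/
def Constraint.poly {n k : ℕ} {Ω : Type*} [Fintype Ω] [DecidableEq Ω]
    {L : Finset (Equiv.Perm Ω)} (P : (Fin k → Ω) → Bool) (f : Constraint n k L) :
    MvPolynomial (Fin n × Ω) ℝ :=
  ∑ a : Fin k → Ω with P (fun j => (f.2 j : Equiv.Perm Ω) (a j)) = true,
    ∏ j, MvPolynomial.X (f.1 j, a j)

/-- The fraction of satisfied constraints, as a polynomial. -/
def CSPInstance.valuePoly {n m k : ℕ} {Ω : Type*} [Fintype Ω] [DecidableEq Ω]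
    {L : Finset (Equiv.Perm Ω)} (P : (Fin k → Ω) → Bool) (I : CSPInstance n m k L) :
    MvPolynomial (Fin n × Ω) ℝ :=
  MvPolynomial.C ((m : ℝ)⁻¹) * ∑ f : Fin m, Constraint.poly P (I f)

/-- Degree-`D` pseudoexpectations.  Only the values of `E` on polynomials of degree at most `D`
are constrained; every linear functional on those extends linearly to all polynomials. -/
structure IsPseudoexpectation {V : Type*} (D : ℕ) (E : MvPolynomial V ℝ →ₗ[ℝ] ℝ) : Prop where
  map_one : E 1 = 1
  sq_nonneg : ∀ p : MvPolynomial V ℝ, 2 * p.totalDegree ≤ D → 0 ≤ E (p ^ 2)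

/-- The degree-`D` pseudoexpectation `E` satisfies the polynomial identity `p = 0`. -/
def SatisfiesIdentity {V : Type*} (D : ℕ) (E : MvPolynomial V ℝ →ₗ[ℝ] ℝ)
    (p : MvPolynomial V ℝ) : Prop :=
  ∀ r : MvPolynomial V ℝ, (p * r).totalDegree ≤ D → E (p * r) = 0

/-- Degree-`D` pseudoexpectations on assignments `Fin n → Ω`: the identities
`∑ c, X (i, c) = 1` and `X (i, c) ^ 2 = X (i, c)` are satisfied. -/
structure IsAssignmentPseudoexpectation {n : ℕ} {Ω : Type*} [Fintype Ω] (D : ℕ)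
    (E : MvPolynomial (Fin n × Ω) ℝ →ₗ[ℝ] ℝ) : Prop extends IsPseudoexpectation D E where
  sum_eq_one : ∀ i : Fin n, SatisfiesIdentity D E (∑ c : Ω, MvPolynomial.X (i, c) - 1)
  sq_eq_self : ∀ (i : Fin n) (c : Ω),
    SatisfiesIdentity D E (MvPolynomial.X (i, c) ^ 2 - MvPolynomial.X (i, c))

/-- Degree-`D` SOS `δ`-refutes the instance `I`: the degree-`D` SOS relaxation certifies that at
most a `1 - δ` fraction of the constraints can be satisfied, i.e. every degree-`D`
pseudoexpectation on assignments gives the fraction of satisfied constraints at most `1 - δ`. -/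
def SOSRefutes {n m k : ℕ} {Ω : Type*} [Fintype Ω] [DecidableEq Ω]
    {L : Finset (Equiv.Perm Ω)} (D : ℕ) (P : (Fin k → Ω) → Bool) (δ : ℝ)
    (I : CSPInstance n m k L) : Prop :=
  ∀ E : MvPolynomial (Fin n × Ω) ℝ →ₗ[ℝ] ℝ, IsAssignmentPseudoexpectation D E →
    E (I.valuePoly P) ≤ 1 - δ

/-! ### Parameters -/

/-- `ε = 2^{log n / (2 log Δ)} / √n`. -/
def slack (n : ℕ) (Δ : ℝ) : ℝ :=
  (2 : ℝ) ^ (Real.log n / (2 * Real.log Δ)) / √(n : ℝ)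

/-- `D = β^{C/t} / (k · 2^{C k/t}) · n / (Δ^{2/(t-1)} log Δ)`. -/
def sosDegree (C β : ℝ) (k t n : ℕ) (Δ : ℝ) : ℝ :=
  β ^ (C / (t : ℝ)) / ((k : ℝ) * (2 : ℝ) ^ (C * (k : ℝ) / (t : ℝ))) *
    ((n : ℝ) / (Δ ^ (2 / ((t : ℝ) - 1)) * Real.log Δ))

end RandomCSP

end

/-!
Let `μ` be a `t`-wise uniform distribution at distance `δ_P(t)` from the distributions supported
on satisfying assignments. Planting `μ` on all constraints gives, for every set `Q` of variables,
the density `∏ f, μ_f^Q`, where `μ_f^Q` is the marginal of `μ` on the variables of the constraint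
`f` in `Q`; it is `1` unless there are more than `t` of them.

Call a set of variables tight if its weight `2 |Q| - ∑ f, max (2 |N f ∩ Q| - (t + 1)) 0` is
smaller than that of every small superset. In a small proper superset of a tight set some new
variable lies in at most one relevant constraint and can be summed out, so the densities of all
small supersets of a tight set have the same marginal on it. The pseudoexpectation of a monomial is
its planted expectation on the tight closure of its variables.

A minimal vertex separation between two tight sets `A` and `B` has weights that contradict
tightness unless no relevant constraint crosses from `A` to `B` within `A ∪ B`. So the variables
in `A` and `B` are conditionally independent given those in `A ∩ B`. Orthogonalizing the functions
on each tight set against those on smaller tight sets therefore makes the pseudoexpectation of a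
square a sum of expectations of squares.

An exponential moment bound and a union bound over small sets show that in a random instance all
small sets have weight proportional to their size, so that tight closures stay small, and that all
but a fraction `1 / √n` of the constraints are isolated: the pseudoexpectation distributes their
variables exactly according to `μ`, so they are satisfied with pseudoprobability at least
`1 - δ_P(t)`.
-/

noncomputable section

namespace RandomCSP

open Finset
open scoped BigOperators

/-! ### Averages over coordinates -/

section Averaging

variable {V Ω X : Type*}

/-- The algebra of functions that depend only on the coordinates in `A`. -/
def juntas (Ω : Type*) (A : Finset V) : Subalgebra ℝ ((V → Ω) → ℝ) where
  carrier := {g | DependsOn g (A : Set V)}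
  add_mem' hg hh _ _ hxy := congrArg₂ (· + ·) (hg hxy) (hh hxy)
  mul_mem' hg hh _ _ hxy := congrArg₂ (· * ·) (hg hxy) (hh hxy)
  algebraMap_mem' _ _ _ _ := rfl

lemma juntas_mono {A B : Finset V} (h : A ⊆ B) : juntas Ω A ≤ juntas Ω B :=
  fun _ hg => DependsOn.mono (Finset.coe_subset.2 h) hg

/-- The average of a function on a finite set. -/
def mean [Fintype X] : (X → ℝ) →ₗ[ℝ] ℝ where
  toFun g := 𝔼 x, g x
  map_add' g h := expect_add_distrib univ g h
  map_smul' c g := (mul_expect univ g c).symm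

lemma mean_apply [Fintype X] (g : X → ℝ) : mean g = 𝔼 x, g x := rfl

lemma mean_nonneg [Fintype X] {g : X → ℝ} (hg : ∀ x, 0 ≤ g x) : 0 ≤ mean g :=
  expect_nonneg fun x _ => hg x

lemma mean_const [Fintype X] [Nonempty X] (c : ℝ) : mean (fun _ : X => c) = c :=
  Fintype.expect_const c

variable [DecidableEq V] {A B : Finset V} {g : (V → Ω) → ℝ}

lemma apply_piecewise_of_mem_juntas (hg : g ∈ juntas Ω A) (x y : V → Ω) :
    g (A.piecewise x y) = g x :=
  hg fun _ hi => A.piecewise_eq_of_mem x y (mem_coe.1 hi)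

variable [Fintype V] [Fintype Ω]

/-- The conditional average of `g` given the coordinates in `A`: all coordinates outside `A` are
averaged out. -/
def avg (A : Finset V) (g : (V → Ω) → ℝ) (x : V → Ω) : ℝ :=
  𝔼 y, g (A.piecewise x y)

lemma avg_empty (g : (V → Ω) → ℝ) (x : V → Ω) : avg ∅ g x = mean g := by
  simp only [avg, piecewise_empty, mean_apply]

lemma avg_mem_juntas (A : Finset V) (g : (V → Ω) → ℝ) : avg A g ∈ juntas Ω A := fun _ _ h =>
  expect_congr rfl fun _ _ => congrArg g (A.piecewise_congr (fun i hi => h i hi) fun _ _ => rfl)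

lemma avg_nonneg (hg : ∀ x, 0 ≤ g x) (x : V → Ω) : 0 ≤ avg A g x :=
  expect_nonneg fun _ _ => hg _

lemma avg_mul_left (hg : g ∈ juntas Ω A) (h : (V → Ω) → ℝ) : avg A (g * h) = g * avg A h := by
  ext x
  simp only [avg, Pi.mul_apply, apply_piecewise_of_mem_juntas hg, mul_expect]

lemma expect_expect_piecewise [Nonempty Ω] (B : Finset V) (G : (V → Ω) → ℝ) :
    𝔼 y : V → Ω, 𝔼 z : V → Ω, G (B.piecewise y z) = 𝔼 y, G y := by
  have hswap : Function.Involutive fun p : (V → Ω) × (V → Ω) =>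
      (B.piecewise p.1 p.2, B.piecewise p.2 p.1) := fun p => by
    ext i <;> by_cases hi : i ∈ B <;> simp [hi]
  calc 𝔼 y : V → Ω, 𝔼 z : V → Ω, G (B.piecewise y z)
      = 𝔼 p : (V → Ω) × (V → Ω), G (B.piecewise p.1 p.2) :=
        (expect_product univ univ fun p : (V → Ω) × (V → Ω) => G (B.piecewise p.1 p.2)).symm
    _ = 𝔼 p : (V → Ω) × (V → Ω), G p.1 :=
        Fintype.expect_equiv hswap.toPerm _ (fun p => G p.1) fun _ => rfl
    _ = 𝔼 y, G y := by
        rw [← univ_product_univ, expect_product]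
        exact expect_congr rfl fun y _ => Fintype.expect_const (G y)

lemma apply_piecewise_eq_zero_of_avg_eq_zero (hg : ∀ x, 0 ≤ g x) {x : V → Ω} (h : avg A g x = 0)
    (y : V → Ω) : g (A.piecewise x y) = 0 :=
  (Finset.expect_eq_zero_iff_of_nonneg fun _ _ => hg _).1 h y (mem_univ y)

lemma avg_mul_div_avg_mul_avg {h : (V → Ω) → ℝ} (hh : ∀ x, 0 ≤ h x) :
    avg A (g * h) / avg A h * avg A h = avg A (g * h) := by
  ext x
  simp only [Pi.mul_apply, Pi.div_apply]
  refine div_mul_cancel_of_imp fun h0 => expect_eq_zero fun y _ => ?_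
  rw [Pi.mul_apply, apply_piecewise_eq_zero_of_avg_eq_zero hh h0, mul_zero]

variable [Nonempty Ω]

lemma avg_of_mem_juntas (hg : g ∈ juntas Ω A) : avg A g = g := by
  ext x
  simp only [avg, apply_piecewise_of_mem_juntas hg, Fintype.expect_const]

lemma avg_avg (A B : Finset V) (g : (V → Ω) → ℝ) : avg A (avg B g) = avg (A ∩ B) g := by
  ext x
  have piecewise_piecewise : ∀ y z : V → Ω,
      B.piecewise (A.piecewise x y) z = (A ∩ B).piecewise x (B.piecewise y z) := by
    intro y z
    ext i
    by_cases hA : i ∈ A <;> by_cases hB : i ∈ B <;> simp [hA, hB]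
  simp only [avg, piecewise_piecewise]
  exact expect_expect_piecewise B fun y => g ((A ∩ B).piecewise x y)

lemma mean_avg (A : Finset V) (g : (V → Ω) → ℝ) : mean (avg A g) = mean g := by
  have x : V → Ω := Classical.arbitrary _
  rw [← avg_empty _ x, avg_avg, empty_inter, avg_empty]

lemma mean_mul_avg (hg : g ∈ juntas Ω A) (h : (V → Ω) → ℝ) :
    mean (g * avg A h) = mean (g * h) := by
  rw [← avg_mul_left hg, mean_avg]

lemma avg_eq_avg_inter (hg : g ∈ juntas Ω B) (A : Finset V) : avg A g = avg (A ∩ B) g := by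
  conv_lhs => rw [← avg_of_mem_juntas hg]
  exact avg_avg A B g

lemma avg_mem_juntas_inter (hg : g ∈ juntas Ω B) (A : Finset V) : avg A g ∈ juntas Ω (A ∩ B) :=
  avg_eq_avg_inter hg A ▸ avg_mem_juntas (A ∩ B) g

end Averaging

/-! ### Products of marginal densities -/

section LocalDensity

variable {V Ω F : Type*} [Fintype V] [DecidableEq V] [Fintype Ω]
  {t : ℕ} {N : F → Finset V} {φ : F → (V → Ω) → ℝ} {Q S : Finset V} {v : V}

/-- The densities `φ f` of `t`-wise uniform distributions, with respect to the uniform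
distribution, on the variables in the neighborhoods `N f`. -/
structure IsWiseDensity (t : ℕ) (N : F → Finset V) (φ : F → (V → Ω) → ℝ) : Prop where
  nonneg : ∀ f x, 0 ≤ φ f x
  mem_juntas : ∀ f, φ f ∈ juntas Ω (N f)
  avg_eq_one : ∀ f (A : Finset V), #(N f ∩ A) ≤ t → avg A (φ f) = 1

/-- The variable `v` lies in at most one constraint with more than `t` variables in `Q`, so that
averaging over `v` only affects one factor of `localDensity φ Q`. -/
def Eliminable (t : ℕ) (N : F → Finset V) (Q : Finset V) (v : V) : Prop :=
  ∀ f g, v ∈ N f → v ∈ N g → t < #(N f ∩ Q) → t < #(N g ∩ Q) → f = g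

lemma IsWiseDensity.avg_erase [Nonempty Ω] (hφ : IsWiseDensity t N φ) {f : F}
    (h : v ∈ N f → #(N f ∩ Q) ≤ t) : avg (Q.erase v) (φ f) = avg Q (φ f) := by
  by_cases hv : v ∈ N f
  · rw [hφ.avg_eq_one f Q (h hv), hφ.avg_eq_one f]
    exact (card_le_card (inter_subset_inter_left (Q.erase_subset v))).trans (h hv)
  · rw [avg_eq_avg_inter (hφ.mem_juntas f), erase_inter, erase_eq_of_notMem (by simp [hv]),
      ← avg_eq_avg_inter (hφ.mem_juntas f)]

variable [Fintype F]

/-- The density of the planted distribution on the variables in `Q`: the product of the marginals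
of the densities `φ f` on these variables. -/
def localDensity (φ : F → (V → Ω) → ℝ) (Q : Finset V) : (V → Ω) → ℝ :=
  ∏ f, avg Q (φ f)

lemma localDensity_mem_juntas (φ : F → (V → Ω) → ℝ) (Q : Finset V) :
    localDensity φ Q ∈ juntas Ω Q :=
  prod_mem fun f _ => avg_mem_juntas Q (φ f)

lemma prod_avg_nonneg {ι : Type*} {φ : ι → (V → Ω) → ℝ} (hφ : ∀ i x, 0 ≤ φ i x) (s : Finset ι)
    (A : Finset V) (x : V → Ω) : 0 ≤ (∏ i ∈ s, avg A (φ i)) x := by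
  rw [Finset.prod_apply]
  exact prod_nonneg fun i _ => avg_nonneg (hφ i) x

lemma IsWiseDensity.localDensity_nonneg (hφ : IsWiseDensity t N φ) (Q : Finset V) (x : V → Ω) :
    0 ≤ localDensity φ Q x :=
  prod_avg_nonneg hφ.nonneg univ Q x

variable [Nonempty Ω]

lemma IsWiseDensity.avg_localDensity_erase (hφ : IsWiseDensity t N φ) (h : Eliminable t N Q v) :
    avg (Q.erase v) (localDensity φ Q) = localDensity φ (Q.erase v) := by
  classical
  by_cases hf : ∃ f, v ∈ N f ∧ t < #(N f ∩ Q)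
  · obtain ⟨f, hvf, hf⟩ := hf
    have hothers : ∏ g ∈ univ.erase f, avg Q (φ g) = ∏ g ∈ univ.erase f, avg (Q.erase v) (φ g) := by
      refine prod_congr rfl fun g hg => (hφ.avg_erase fun hv => ?_).symm
      by_contra! hcon
      exact ne_of_mem_erase hg (h g f hv hvf hcon hf)
    unfold localDensity
    rw [← prod_erase_mul _ _ (mem_univ f), ← prod_erase_mul _ _ (mem_univ f), hothers,
      avg_mul_left (prod_mem fun g _ => avg_mem_juntas _ _), avg_avg,
      inter_eq_left.2 (Q.erase_subset v)]
  · push Not at hf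
    have hall : localDensity φ Q = localDensity φ (Q.erase v) :=
      prod_congr rfl fun g _ => (hφ.avg_erase (hf g)).symm
    rw [hall, avg_of_mem_juntas (localDensity_mem_juntas φ _)]

lemma IsWiseDensity.avg_localDensity (hφ : IsWiseDensity t N φ) (Q : Finset V) (hSQ : S ⊆ Q)
    (h : ∀ M, S ⊂ M → M ⊆ Q → ∃ v ∈ M \ S, Eliminable t N M v) :
    avg S (localDensity φ Q) = localDensity φ S := by
  induction Q using Finset.strongInduction with
  | H Q ih =>
    obtain rfl | hSQ' := hSQ.eq_or_ssubset
    · exact avg_of_mem_juntas (localDensity_mem_juntas φ _)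
    obtain ⟨v, hv, hvQ⟩ := h Q hSQ' subset_rfl
    rw [Finset.mem_sdiff] at hv
    have hSv : S ⊆ Q.erase v := subset_erase.2 ⟨hSQ, hv.2⟩
    rw [← ih (Q.erase v) (erase_ssubset hv.1) hSv
        fun M hSM hM => h M hSM (hM.trans (Q.erase_subset v)),
      ← hφ.avg_localDensity_erase hvQ, avg_avg, inter_eq_left.2 hSv]

lemma IsWiseDensity.mean_mul_localDensity (hφ : IsWiseDensity t N φ) (hSQ : S ⊆ Q)
    (h : ∀ M, S ⊂ M → M ⊆ Q → ∃ v ∈ M \ S, Eliminable t N M v)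
    {g : (V → Ω) → ℝ} (hg : g ∈ juntas Ω S) :
    mean (g * localDensity φ Q) = mean (g * localDensity φ S) := by
  rw [← hφ.avg_localDensity Q hSQ h, mean_mul_avg hg]

end LocalDensity

/-! ### The weight of a set of variables, tight sets and separations -/

section Weight

variable {V F : Type*} [DecidableEq V] {t : ℕ} {N : F → Finset V} {A B M X : Finset V} {v : V}

/-- The amount by which the constraint `f` lowers the weight of `M`. -/
def excess (t : ℕ) (N : F → Finset V) (M : Finset V) (f : F) : ℤ :=
  max (2 * (#(N f ∩ M) : ℤ) - (t + 1)) 0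

lemma excess_nonneg (f : F) : 0 ≤ excess t N M f :=
  le_max_right _ _

lemma excess_add_excess_le (A B : Finset V) (f : F) :
    excess t N A f + excess t N B f ≤ excess t N (A ∪ B) f + excess t N (A ∩ B) f := by
  have hcard := card_union_add_card_inter (N f ∩ A) (N f ∩ B)
  rw [← inter_union_distrib_left, ← inter_inter_distrib_left] at hcard
  have hA : #(N f ∩ A) ≤ #(N f ∩ (A ∪ B)) :=
    card_le_card (inter_subset_inter_left subset_union_left)
  have hB : #(N f ∩ B) ≤ #(N f ∩ (A ∪ B)) :=
    card_le_card (inter_subset_inter_left subset_union_right)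
  unfold excess
  omega

lemma card_inter_add_card_inter_sdiff (hAX : A ⊆ X) (S : Finset V) :
    #(S ∩ A) + #(S ∩ (X \ A)) = #(S ∩ X) := by
  rw [← card_union_of_disjoint, ← inter_union_distrib_left, union_sdiff_of_subset hAX]
  exact disjoint_sdiff.mono inter_subset_right inter_subset_right

lemma sum_card_inter_eq_sum_card_filter_mem (S : Finset V) (G : Finset F) :
    ∑ f ∈ G, #(N f ∩ S) = ∑ v ∈ S, #{f ∈ G | v ∈ N f} := by
  have hfilter (f : F) : N f ∩ S = {v ∈ S | v ∈ N f} := by rw [filter_mem_eq_inter, inter_comm]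
  simp only [hfilter]
  exact (sum_card_bipartiteAbove_eq_sum_card_bipartiteBelow fun v f => v ∈ N f).symm

variable [Fintype F]

/-- Twice the number of variables in `M` minus the excesses of the constraints: a lower bound on
the weight of the small sets of variables replaces the expansion of the constraint hypergraph. -/
def weight (t : ℕ) (N : F → Finset V) (M : Finset V) : ℤ :=
  2 * #M - ∑ f, excess t N M f

/-- Every set of at most `b` variables has weight at least `η` times its size. -/
def IsExpanding (t : ℕ) (N : F → Finset V) (η : ℝ) (b : ℕ) : Prop :=
  ∀ M : Finset V, #M ≤ b → η * #M ≤ weight t N M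

/-- Every proper superset of `A` with at most `b` elements has larger weight. -/
def IsTight (t : ℕ) (N : F → Finset V) (b : ℕ) (A : Finset V) : Prop :=
  ∀ X, A ⊂ X → #X ≤ b → weight t N A < weight t N X

lemma weight_le (M : Finset V) : weight t N M ≤ 2 * #M :=
  sub_le_self _ (sum_nonneg fun _ _ => excess_nonneg _)

@[simp]
lemma weight_empty : weight t N ∅ = 0 := by
  simp [weight, excess]

lemma weight_union_add_weight_inter (A B : Finset V) :
    weight t N (A ∪ B) + weight t N (A ∩ B) ≤ weight t N A + weight t N B := by
  have hcard : (#(A ∪ B) : ℤ) + #(A ∩ B) = #A + #B := by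
    exact_mod_cast card_union_add_card_inter A B
  have hexcess := sum_le_sum fun f (_ : f ∈ univ) => excess_add_excess_le (t := t) (N := N) A B f
  rw [sum_add_distrib, sum_add_distrib] at hexcess
  unfold weight
  linarith

lemma sum_card_inter_sdiff_add_min_le (hAX : A ⊆ X) {G : Finset F}
    (hG : ∀ f ∈ G, t < #(N f ∩ X)) :
    ∑ f ∈ G, (#(N f ∩ (X \ A)) : ℤ) + ∑ f ∈ G, (min #(N f ∩ A) #(N f ∩ (X \ A)) : ℤ)
      ≤ ∑ f, excess t N X f - ∑ f, excess t N A f := by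
  rw [← sum_add_distrib, ← sum_sub_distrib]
  calc ∑ f ∈ G, ((#(N f ∩ (X \ A)) : ℤ) + (min #(N f ∩ A) #(N f ∩ (X \ A)) : ℤ))
      ≤ ∑ f ∈ G, (excess t N X f - excess t N A f) := by
        refine sum_le_sum fun f hf => ?_
        have hcard := card_inter_add_card_inter_sdiff hAX (N f)
        have hlarge := hG f hf
        unfold excess
        omega
    _ ≤ ∑ f, (excess t N X f - excess t N A f) := by
        refine sum_le_univ_sum_of_nonneg fun f => ?_
        have hcard := card_inter_add_card_inter_sdiff hAX (N f)
        unfold excess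
        omega

lemma weight_le_weight_add (hAX : A ⊆ X) {G : Finset F} (hG : ∀ f ∈ G, t < #(N f ∩ X)) :
    weight t N X ≤ weight t N A + 2 * #(X \ A) - ∑ v ∈ X \ A, (#{f ∈ G | v ∈ N f} : ℤ)
      - ∑ f ∈ G, (min #(N f ∩ A) #(N f ∩ (X \ A)) : ℤ) := by
  have hcard : (#(X \ A) : ℤ) + #A = #X := by exact_mod_cast card_sdiff_add_card_eq_card hAX
  have hdegree : ∑ f ∈ G, (#(N f ∩ (X \ A)) : ℤ) = ∑ v ∈ X \ A, (#{f ∈ G | v ∈ N f} : ℤ) := by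
    exact_mod_cast sum_card_inter_eq_sum_card_filter_mem (X \ A) G
  have hexcess := sum_card_inter_sdiff_add_min_le hAX hG
  rw [hdegree] at hexcess
  unfold weight
  linarith

lemma two_le_card_of_not_eliminable {Q : Finset V} (h : ¬ Eliminable t N Q v) :
    2 ≤ #{f | t < #(N f ∩ Q) ∧ v ∈ N f} := by
  unfold Eliminable at h
  push Not at h
  obtain ⟨f, g, hf, hg, hfQ, hgQ, hne⟩ := h
  exact one_lt_card.2 ⟨f, by simp [hf, hfQ], g, by simp [hg, hgQ], hne⟩

lemma weight_add_sum_min_le (hAM : A ⊆ M) (h : ∀ v ∈ M \ A, ¬ Eliminable t N M v) :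
    weight t N M + ∑ f with t < #(N f ∩ M), (min #(N f ∩ A) #(N f ∩ (M \ A)) : ℤ)
      ≤ weight t N A := by
  have hgain := weight_le_weight_add (t := t) (N := N) hAM
    (G := {f | t < #(N f ∩ M)}) fun f hf => (mem_filter.1 hf).2
  have hdegree : ∑ _ ∈ M \ A, (2 : ℤ)
      ≤ ∑ v ∈ M \ A, (#{f ∈ ({f | t < #(N f ∩ M)} : Finset F) | v ∈ N f} : ℤ) :=
    sum_le_sum fun _ hv => by
      rw [filter_filter]
      exact_mod_cast two_le_card_of_not_eliminable (h _ hv)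
  simp only [sum_const, nsmul_eq_mul] at hdegree
  linarith

lemma weight_le_weight_of_forall_not_eliminable (hAM : A ⊆ M)
    (h : ∀ v ∈ M \ A, ¬ Eliminable t N M v) : weight t N M ≤ weight t N A :=
  (le_add_of_nonneg_right (sum_nonneg fun _ _ => by positivity)).trans
    (weight_add_sum_min_le hAM h)

lemma IsTight.exists_eliminable {b : ℕ} (hA : IsTight t N b A) (hAM : A ⊂ M) (hM : #M ≤ b) :
    ∃ v ∈ M \ A, Eliminable t N M v := by
  by_contra! hnone
  exact (hA M hAM hM).not_ge (weight_le_weight_of_forall_not_eliminable hAM.1 hnone)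

end Weight

section Separation

variable {V F : Type*} [DecidableEq V] {t : ℕ} {N : F → Finset V} {A B Q X Y : Finset V}

/-- The sets `X ⊇ A` and `Y ⊇ B` cover `Q`, and no constraint with more than `t` variables in `Q`
crosses from `X` to `Y`: a vertex separator `X ∩ Y` between `A` and `B`. -/
structure IsSeparation (t : ℕ) (N : F → Finset V) (A B Q X Y : Finset V) : Prop where
  subset_left : A ⊆ X
  subset_right : B ⊆ Y
  union_eq : X ∪ Y = Q
  side : ∀ f, t < #(N f ∩ Q) → N f ∩ Q ⊆ X ∨ N f ∩ Q ⊆ Y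

/-- A separation whose separator `X ∩ Y` is as small as possible. -/
structure IsMinSeparation (t : ℕ) (N : F → Finset V) (A B Q X Y : Finset V) : Prop
    extends IsSeparation t N A B Q X Y where
  card_le : ∀ X' Y', IsSeparation t N A B Q X' Y' → #(X ∩ Y) ≤ #(X' ∩ Y')

lemma IsSeparation.symm (h : IsSeparation t N A B Q X Y) : IsSeparation t N B A Q Y X :=
  ⟨h.subset_right, h.subset_left, by rw [union_comm, h.union_eq], fun f hf => (h.side f hf).symm⟩

lemma IsMinSeparation.symm (h : IsMinSeparation t N A B Q X Y) : IsMinSeparation t N B A Q Y X :=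
  ⟨h.toIsSeparation.symm, fun X' Y' h' => by
    rw [inter_comm, inter_comm X']
    exact h.card_le _ _ h'.symm⟩

lemma IsSeparation.left_subset (h : IsSeparation t N A B Q X Y) : X ⊆ Q :=
  h.union_eq ▸ subset_union_left

lemma IsSeparation.right_subset (h : IsSeparation t N A B Q X Y) : Y ⊆ Q :=
  h.union_eq ▸ subset_union_right

variable [Fintype F]

/-- The constraints with more than `t` variables in `Q`, all of them in `X`. -/
def sideConstraints (t : ℕ) (N : F → Finset V) (Q X : Finset V) : Finset F :=
  {f | t < #(N f ∩ Q) ∧ N f ∩ Q ⊆ X}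

lemma mem_sideConstraints {f : F} :
    f ∈ sideConstraints t N Q X ↔ t < #(N f ∩ Q) ∧ N f ∩ Q ⊆ X := by
  simp [sideConstraints]

lemma lt_card_inter_of_mem_sideConstraints {f : F} (hf : f ∈ sideConstraints t N Q X) :
    t < #(N f ∩ X) := by
  obtain ⟨hft, hfX⟩ := mem_sideConstraints.1 hf
  exact hft.trans_le (card_le_card (subset_inter inter_subset_left hfX))

lemma IsSeparation.recut (h : IsSeparation t N A B Q X Y) {U : Finset V} (hUQ : U ⊆ Q)
    (hAU : X ∩ Y ∩ A ⊆ U)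
    (hU : ∀ f ∈ sideConstraints t N Q X, N f ∩ A ⊆ U ∨ N f ∩ (X \ A) ⊆ U) :
    IsSeparation t N A B Q (A ∪ U) (Q \ A ∪ U) where
  subset_left := subset_union_left
  subset_right v hv := by
    by_cases hvA : v ∈ A
    · exact mem_union_right _ (hAU (by simp [h.subset_left hvA, h.subset_right hv, hvA]))
    · exact mem_union_left _ (by simp [h.right_subset (h.subset_right hv), hvA])
  union_eq := by
    rw [← union_union_distrib_right,
      union_sdiff_of_subset (h.subset_left.trans h.left_subset), union_eq_left.2 hUQ]
  side f hf := by
    have inside {S : Finset V} (hS : N f ∩ A ⊆ U) (hSQ : N f ∩ Q = S) : S ⊆ Q \ A ∪ U := by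
      intro v hv
      have hv' := mem_inter.1 (hSQ ▸ hv)
      by_cases hvA : v ∈ A
      · exact mem_union_right _ (hS (mem_inter.2 ⟨hv'.1, hvA⟩))
      · exact mem_union_left _ (Finset.mem_sdiff.2 ⟨hv'.2, hvA⟩)
    obtain hX | hY := h.side f hf
    · obtain hA | hXA := hU f (mem_sideConstraints.2 ⟨hf, hX⟩)
      · exact Or.inr (inside hA rfl)
      · refine Or.inl fun v hv => ?_
        by_cases hvA : v ∈ A
        · exact mem_union_left _ hvA
        · exact mem_union_right _ (hXA (by simp [hX hv, hvA, (mem_inter.1 hv).1]))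
    · refine Or.inr (inside (fun v hv => hAU ?_) rfl)
      obtain ⟨hvf, hvA⟩ := mem_inter.1 hv
      have hvX := h.subset_left hvA
      simp [hvX, hvA, hY (mem_inter.2 ⟨hvf, h.left_subset hvX⟩)]

lemma IsMinSeparation.card_inter_sdiff_le (h : IsMinSeparation t N A B Q X Y) :
    #((X ∩ Y) \ A) ≤ ∑ f ∈ sideConstraints t N Q X, min #(N f ∩ A) #(N f ∩ (X \ A)) := by
  classical
  let smaller (f : F) : Finset V :=
    if #(N f ∩ A) ≤ #(N f ∩ (X \ A)) then N f ∩ A else N f ∩ (X \ A)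
  have card_smaller (f : F) : #(smaller f) = min #(N f ∩ A) #(N f ∩ (X \ A)) := by
    simp only [smaller]
    split_ifs <;> omega
  have smaller_subset (f : F) : smaller f ⊆ X := by
    simp only [smaller]
    split_ifs
    · exact inter_subset_right.trans h.subset_left
    · exact inter_subset_right.trans sdiff_subset
  set U := X ∩ Y ∩ A ∪ (sideConstraints t N Q X).biUnion smaller
  have hUQ : U ⊆ Q := (union_subset (inter_subset_left.trans inter_subset_left)
    (biUnion_subset.2 fun f _ => smaller_subset f)).trans h.left_subset
  have hsep : IsSeparation t N A B Q (A ∪ U) (Q \ A ∪ U) := by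
    refine h.recut hUQ subset_union_left fun f hf => ?_
    have hfU : smaller f ⊆ U := (subset_biUnion_of_mem smaller hf).trans subset_union_right
    simp only [smaller] at hfU
    split_ifs at hfU
    exacts [Or.inl hfU, Or.inr hfU]
  have hinter : (A ∪ U) ∩ (Q \ A ∪ U) = U := by
    rw [← inter_union_distrib_right, inter_sdiff_self, empty_union]
  have hU : #U ≤ #(X ∩ Y ∩ A)
      + ∑ f ∈ sideConstraints t N Q X, min #(N f ∩ A) #(N f ∩ (X \ A)) := by
    simp only [← card_smaller]
    exact (card_union_le _ _).trans (Nat.add_le_add_left card_biUnion_le _)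
  have hmin := h.card_le _ _ hsep
  rw [hinter] at hmin
  have hcard := card_sdiff_add_card_inter (X ∩ Y) A
  omega

lemma IsMinSeparation.exists_mem_sideConstraints (h : IsMinSeparation t N A B Q X Y) {v : V}
    (hv : v ∈ X ∩ Y) (hvA : v ∉ A) : ∃ f ∈ sideConstraints t N Q X, v ∈ N f := by
  by_contra! hnone
  have hsep : IsSeparation t N A B Q (X.erase v) Y := by
    refine ⟨subset_erase.2 ⟨h.subset_left, hvA⟩, h.subset_right, ?_, fun f hf => ?_⟩
    · rw [erase_union_of_mem (mem_inter.1 hv).2, h.union_eq]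
    · refine (h.side f hf).imp_left fun hX => subset_erase.2 ⟨hX, fun hvf => ?_⟩
      exact hnone f (mem_sideConstraints.2 ⟨hf, hX⟩) (mem_inter.1 hvf).1
  have hmin := h.card_le _ _ hsep
  rw [erase_inter] at hmin
  exact hmin.not_gt (card_erase_lt_of_mem hv)

lemma IsSeparation.two_le_card_sideConstraints (h : IsSeparation t N A B Q X Y) {v : V}
    (hvQ : v ∈ Q) (hvY : v ∉ Y) (hv : ¬ Eliminable t N Q v) :
    2 ≤ #{f ∈ sideConstraints t N Q X | v ∈ N f} := by
  refine (two_le_card_of_not_eliminable hv).trans (card_le_card fun f hf => ?_)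
  obtain ⟨hft, hvf⟩ := (mem_filter_univ f).1 hf
  refine mem_filter.2 ⟨mem_sideConstraints.2 ⟨hft, (h.side f hft).resolve_right fun hY => ?_⟩, hvf⟩
  exact hvY (hY (mem_inter.2 ⟨hvf, hvQ⟩))

lemma IsMinSeparation.weight_le (h : IsMinSeparation t N A B Q X Y)
    (hQ : ∀ v ∈ Q, v ∉ A → v ∉ B → ¬ Eliminable t N Q v) : weight t N X ≤ weight t N A := by
  set G := sideConstraints t N Q X
  have hdegree : ∀ v ∈ X \ A, (2 : ℤ) - (if v ∈ Y then 1 else 0) ≤ #{f ∈ G | v ∈ N f} := by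
    intro v hv
    obtain ⟨hvX, hvA⟩ := Finset.mem_sdiff.1 hv
    split_ifs with hvY
    · obtain ⟨f, hf, hvf⟩ := h.exists_mem_sideConstraints (mem_inter.2 ⟨hvX, hvY⟩) hvA
      have : 0 < #{f ∈ G | v ∈ N f} := card_pos.2 ⟨f, mem_filter.2 ⟨hf, hvf⟩⟩
      omega
    · have hvQ := h.left_subset hvX
      have : 2 ≤ #{f ∈ G | v ∈ N f} := h.two_le_card_sideConstraints hvQ hvY
        (hQ v hvQ hvA fun hvB => hvY (h.subset_right hvB))
      omega
  have hoverlap : #{v ∈ X \ A | v ∈ Y} = #((X ∩ Y) \ A) := by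
    rw [filter_mem_eq_inter, sdiff_inter_right_comm]
  have hsum : 2 * (#(X \ A) : ℤ) - #((X ∩ Y) \ A) ≤ ∑ v ∈ X \ A, (#{f ∈ G | v ∈ N f} : ℤ) := by
    refine le_of_eq_of_le ?_ (sum_le_sum hdegree)
    rw [sum_sub_distrib, sum_boole, hoverlap, sum_const, nsmul_eq_mul, mul_comm]
  have hcut : (#((X ∩ Y) \ A) : ℤ) ≤ ∑ f ∈ G, (min #(N f ∩ A) #(N f ∩ (X \ A)) : ℤ) := by
    exact_mod_cast h.card_inter_sdiff_le
  have hgain := weight_le_weight_add h.subset_left fun f (hf : f ∈ G) =>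
    lt_card_inter_of_mem_sideConstraints hf
  linarith

end Separation

section TightClosure

variable {V F : Type*} [DecidableEq V] {t : ℕ} {N : F → Finset V} {b : ℕ}
  {A B M Q S : Finset V}

lemma exists_isMinSeparation (t : ℕ) (N : F → Finset V) (hA : A ⊆ Q) (hB : B ⊆ Q) :
    ∃ X Y, IsMinSeparation t N A B Q X Y := by
  obtain ⟨⟨X, Y⟩, hXY, hmin⟩ := exists_minimalFor_of_wellFoundedLT
    (fun p : Finset V × Finset V => IsSeparation t N A B Q p.1 p.2) (fun p => #(p.1 ∩ p.2))
    ⟨(Q, Q), hA, hB, union_self Q, fun f _ => Or.inl inter_subset_right⟩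
  exact ⟨X, Y, hXY, fun X' Y' h => (le_total _ _).elim id (hmin (j := (X', Y')) h)⟩

variable [Fintype F]

lemma IsTight.isSeparation (hA : IsTight t N b A) (hB : IsTight t N b B) (hAQ : A ⊆ Q)
    (hBQ : B ⊆ Q) (hcard : #Q ≤ b) (hQ : ∀ v ∈ Q, v ∉ A → v ∉ B → ¬ Eliminable t N Q v) :
    IsSeparation t N A B Q A B := by
  obtain ⟨X, Y, h⟩ := exists_isMinSeparation t N hAQ hBQ
  have hX : A = X := by
    by_contra hne
    exact (hA X (h.subset_left.ssubset_of_ne hne)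
      ((card_le_card h.left_subset).trans hcard)).not_ge (h.weight_le hQ)
  have hY : B = Y := by
    by_contra hne
    exact (hB Y (h.subset_right.ssubset_of_ne hne)
      ((card_le_card h.right_subset).trans hcard)).not_ge
        (h.symm.weight_le fun v hv hvB hvA => hQ v hv hvA hvB)
  subst hX hY
  exact h.toIsSeparation

lemma IsTight.exists_eliminable_union (hA : IsTight t N b A) (hB : IsTight t N b B)
    (hM : A ∪ B ⊂ M) (hcard : #M ≤ b) : ∃ v ∈ M \ (A ∪ B), Eliminable t N M v := by
  by_contra! hnone
  refine hM.ne (hA.isSeparation hB (subset_union_left.trans hM.1) (subset_union_right.trans hM.1)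
    hcard fun v hv hvA hvB => hnone v ?_).union_eq
  simp [hv, hvA, hvB]

variable [Finite V]

lemma exists_isTight (t : ℕ) (N : F → Finset V) (hS : #S ≤ b) :
    ∃ A, S ⊆ A ∧ #A ≤ b ∧ IsTight t N b A ∧ ∀ M, S ⊆ M → #M ≤ b → weight t N A ≤ weight t N M := by
  have := Fintype.ofFinite V
  obtain ⟨A, hA, hmin⟩ := exists_min_image ({M | S ⊆ M ∧ #M ≤ b} : Finset (Finset V))
    (fun M => toLex (weight t N M, -(#M : ℤ))) ⟨S, by simp [hS]⟩
  simp only [mem_filter_univ, Prod.Lex.toLex_le_toLex] at hA hmin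
  refine ⟨A, hA.1, hA.2, fun X hAX hX => ?_, fun M hSM hM => ?_⟩
  · have hcard := card_lt_card hAX
    exact (hmin X ⟨hA.1.trans hAX.1, hX⟩).resolve_right fun h => by omega
  · exact (hmin M ⟨hSM, hM⟩).elim le_of_lt fun h => h.1.le

/-- The smallest tight set above `S`, obtained as a largest minimizer of the weight among the
supersets of `S` with at most `b` elements (and the junk value `S` if there are none). -/
def tightClosure (t : ℕ) (N : F → Finset V) (b : ℕ) (S : Finset V) : Finset V :=
  if h : #S ≤ b then (exists_isTight t N h).choose else S

lemma tightClosure_spec (t : ℕ) (N : F → Finset V) (h : #S ≤ b) :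
    S ⊆ tightClosure t N b S ∧ #(tightClosure t N b S) ≤ b ∧ IsTight t N b (tightClosure t N b S) ∧
      ∀ M, S ⊆ M → #M ≤ b → weight t N (tightClosure t N b S) ≤ weight t N M := by
  rw [tightClosure, dif_pos h]
  exact (exists_isTight t N h).choose_spec

lemma subset_tightClosure (S : Finset V) : S ⊆ tightClosure t N b S := by
  by_cases h : #S ≤ b
  · exact (tightClosure_spec t N h).1
  · rw [tightClosure, dif_neg h]

lemma card_tightClosure_le (h : #S ≤ b) : #(tightClosure t N b S) ≤ b :=
  (tightClosure_spec t N h).2.1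

lemma isTight_tightClosure (h : #S ≤ b) : IsTight t N b (tightClosure t N b S) :=
  (tightClosure_spec t N h).2.2.1

lemma weight_tightClosure_le (hSM : S ⊆ M) (hM : #M ≤ b) :
    weight t N (tightClosure t N b S) ≤ weight t N M :=
  (tightClosure_spec t N ((card_le_card hSM).trans hM)).2.2.2 M hSM hM

lemma tightClosure_subset (hA : IsTight t N b A) (hSA : S ⊆ A)
    (hcard : #(tightClosure t N b S ∪ A) ≤ b) : tightClosure t N b S ⊆ A := by
  by_contra hnot
  have hlt := hA _ (subset_union_right.ssubset_of_ne fun h => hnot (union_eq_right.1 h.symm)) hcard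
  have hsub := weight_union_add_weight_inter (t := t) (N := N) (tightClosure t N b S) A
  have hmin := weight_tightClosure_le (t := t) (N := N)
    (subset_inter (subset_tightClosure (t := t) (N := N) (b := b) S) hSA)
    ((card_le_card (inter_subset_left.trans subset_union_left)).trans hcard)
  linarith

end TightClosure

/-! ### Positivity -/

section Projection

lemma exists_mem_forall_mean_sub_mul_eq_zero {X : Type*} [Fintype X] {D : X → ℝ}
    (hD : ∀ x, 0 ≤ D x) (W : Submodule ℝ (X → ℝ)) (u : X → ℝ) :
    ∃ l ∈ W, ∀ h ∈ W, mean ((u - l) * h * D) = 0 := by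
  let T : (X → ℝ) →ₗ[ℝ] EuclideanSpace ℝ X :=
    (WithLp.linearEquiv 2 ℝ (X → ℝ)).symm.toLinearMap ∘ₗ LinearMap.mulLeft ℝ fun x => √(D x)
  have inner_T (g h : X → ℝ) : inner ℝ (T g) (T h) = ∑ x, h x * g x * D x := by
    rw [PiLp.inner_apply]
    refine sum_congr rfl fun x _ => ?_
    change √(D x) * h x * (√(D x) * g x) = _
    rw [mul_mul_mul_comm, Real.mul_self_sqrt (hD x), mul_comm]
  obtain ⟨p, hp, r, hr, hpr⟩ := (W.map T).exists_add_mem_mem_orthogonal (T u)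
  obtain ⟨l, hl, rfl⟩ := Submodule.mem_map.1 hp
  refine ⟨l, hl, fun h hh => ?_⟩
  have horth := ((W.map T).mem_orthogonal' r).1 hr _ (Submodule.mem_map_of_mem hh)
  rw [show r = T (u - l) by rw [map_sub, hpr, add_sub_cancel_left], inner_T] at horth
  have hsum : ∑ x, ((u - l) * h * D) x = 0 := by
    rw [← horth]
    exact sum_congr rfl fun x _ => by simp only [Pi.mul_apply, mul_comm (h x)]
  rw [mean_apply, expect, hsum, smul_zero]

variable {V Ω : Type*} [Fintype V] [Fintype Ω]

lemma exists_juntas_forall_mean_sub_sum_mul_eq_zero [DecidableEq V] {D : (V → Ω) → ℝ}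
    (hD : ∀ x, 0 ≤ D x) (𝓒 : Finset (Finset V)) (u : (V → Ω) → ℝ) :
    ∃ l : Finset V → (V → Ω) → ℝ, (∀ C, l C ∈ juntas Ω C) ∧
      ∀ C ∈ 𝓒, ∀ h ∈ juntas Ω C, mean ((u - ∑ C ∈ 𝓒, l C) * h * D) = 0 := by
  obtain ⟨l, hl, horth⟩ := exists_mem_forall_mean_sub_mul_eq_zero hD
    (⨆ C ∈ 𝓒, Subalgebra.toSubmodule (juntas Ω C)) u
  obtain ⟨c, rfl⟩ := (Submodule.mem_iSup_finset_iff_exists_sum _ _).1 hl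
  exact ⟨fun C => c C, fun C => (c C).2, fun C hC h hh =>
    horth h (Submodule.mem_iSup_of_mem C (Submodule.mem_iSup_of_mem hC hh))⟩

end Projection

section Positivity

variable {V Ω F : Type*} [DecidableEq V] [Fintype F] {t b : ℕ} {N : F → Finset V}
  {A B C Q X Y : Finset V} {𝓐 : Finset (Finset V)}

/-- A family of tight sets, closed under intersection, whose pairwise unions have at most `b`
elements. -/
structure IsTightFamily (t : ℕ) (N : F → Finset V) (b : ℕ) (𝓐 : Finset (Finset V)) : Prop where
  isTight : ∀ A ∈ 𝓐, IsTight t N b A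
  card_union_le : ∀ A ∈ 𝓐, ∀ B ∈ 𝓐, #(A ∪ B) ≤ b
  inter_mem : ∀ A ∈ 𝓐, ∀ B ∈ 𝓐, A ∩ B ∈ 𝓐

lemma IsTightFamily.erase (h : IsTightFamily t N b 𝓐) (hmax : ∀ B ∈ 𝓐, A ⊆ B → B = A) :
    IsTightFamily t N b (𝓐.erase A) where
  isTight B hB := h.isTight B (mem_of_mem_erase hB)
  card_union_le B hB C hC := h.card_union_le B (mem_of_mem_erase hB) C (mem_of_mem_erase hC)
  inter_mem B hB C hC := by
    refine mem_erase.2 ⟨fun hA => ne_of_mem_erase hB ?_,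
      h.inter_mem B (mem_of_mem_erase hB) C (mem_of_mem_erase hC)⟩
    exact hmax B (mem_of_mem_erase hB) (hA ▸ inter_subset_left)

variable [Fintype V] [Fintype Ω] {φ : F → (V → Ω) → ℝ}

/-- The bilinear form on families of functions `g A` of the variables in `A` that the local
densities define: the planted expectation of `(∑ A, g A) * (∑ B, h B)`. -/
def gram (φ : F → (V → Ω) → ℝ) (𝓐 : Finset (Finset V)) (g h : Finset V → (V → Ω) → ℝ) : ℝ :=
  ∑ A ∈ 𝓐, ∑ B ∈ 𝓐, mean (g A * h B * localDensity φ (A ∪ B))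

lemma gram_comm (g h : Finset V → (V → Ω) → ℝ) : gram φ 𝓐 g h = gram φ 𝓐 h g := by
  rw [gram, sum_comm]
  simp only [gram, mul_comm (g _), union_comm]

lemma gram_add_left (g g' h : Finset V → (V → Ω) → ℝ) :
    gram φ 𝓐 (g + g') h = gram φ 𝓐 g h + gram φ 𝓐 g' h := by
  simp only [gram, Pi.add_apply, add_mul, map_add, sum_add_distrib]

lemma gram_sub_left (g g' h : Finset V → (V → Ω) → ℝ) :
    gram φ 𝓐 (g - g') h = gram φ 𝓐 g h - gram φ 𝓐 g' h := by
  rw [eq_sub_iff_add_eq, ← gram_add_left, sub_add_cancel]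

lemma gram_add_self_of_gram_eq_zero {g d : Finset V → (V → Ω) → ℝ}
    (hg : gram φ 𝓐 d g = 0) (hd : gram φ 𝓐 d d = 0) :
    gram φ 𝓐 (g + d) (g + d) = gram φ 𝓐 g g := by
  rw [gram_add_left, gram_comm g, gram_comm d, gram_add_left, gram_add_left, hg, hd, gram_comm g d,
    hg]
  ring

lemma gram_self_eq_add_gram_erase (hA : A ∈ 𝓐) (g : Finset V → (V → Ω) → ℝ) :
    gram φ 𝓐 g g = mean (g A * g A * localDensity φ A)
      + 2 * ∑ B ∈ 𝓐.erase A, mean (g A * g B * localDensity φ (A ∪ B))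
      + gram φ (𝓐.erase A) g g := by
  simp only [gram, ← add_sum_erase _ _ hA, sum_add_distrib, union_self, mul_comm _ (g A),
    union_comm _ A]
  ring

variable [Nonempty Ω]

lemma IsSeparation.exists_localDensity_eq_mul (hφ : IsWiseDensity t N φ)
    (h : IsSeparation t N A B Q X Y) :
    ∃ G ∈ juntas Ω X, ∃ H ∈ juntas Ω Y, (∀ x, 0 ≤ H x) ∧ localDensity φ Q = G * H := by
  classical
  have avg_eq {f : F} {Z : Finset V} (hZ : Z ⊆ Q) (hf : N f ∩ Q ⊆ Z) :
      avg Q (φ f) = avg Z (φ f) := by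
    rw [avg_eq_avg_inter (hφ.mem_juntas f), avg_eq_avg_inter (hφ.mem_juntas f) Z, inter_comm,
      inter_comm Z]
    congr 1
    exact (subset_inter inter_subset_left hf).antisymm (inter_subset_inter_left hZ)
  refine ⟨∏ f with N f ∩ Q ⊆ X, avg X (φ f), prod_mem fun f _ => avg_mem_juntas X (φ f),
    ∏ f with ¬ N f ∩ Q ⊆ X, avg Y (φ f), prod_mem fun f _ => avg_mem_juntas Y (φ f),
    prod_avg_nonneg hφ.nonneg _ Y, ?_⟩
  rw [localDensity, ← prod_filter_mul_prod_filter_not univ fun f => N f ∩ Q ⊆ X]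
  congr 1
  · exact prod_congr rfl fun f hf => avg_eq h.left_subset (mem_filter.1 hf).2
  · refine prod_congr rfl fun f hf => ?_
    by_cases hft : t < #(N f ∩ Q)
    · exact avg_eq h.right_subset ((h.side f hft).resolve_left (mem_filter.1 hf).2)
    · rw [hφ.avg_eq_one f Q (not_lt.1 hft), hφ.avg_eq_one f Y]
      exact (card_le_card (inter_subset_inter_left h.right_subset)).trans (not_lt.1 hft)

lemma IsTight.mean_mul_localDensity (hφ : IsWiseDensity t N φ) (hA : IsTight t N b A) (hAQ : A ⊆ Q)
    (hQ : #Q ≤ b) {g : (V → Ω) → ℝ} (hg : g ∈ juntas Ω A) :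
    mean (g * localDensity φ Q) = mean (g * localDensity φ A) :=
  hφ.mean_mul_localDensity hAQ
    (fun _ hAM hMQ => hA.exists_eliminable hAM ((card_le_card hMQ).trans hQ)) hg

lemma IsTight.mean_mul_localDensity_union (hφ : IsWiseDensity t N φ) (hA : IsTight t N b A)
    (hB : IsTight t N b B) (hAQ : A ⊆ Q) (hBQ : B ⊆ Q) (hQ : #Q ≤ b) {g : (V → Ω) → ℝ}
    (hg : g ∈ juntas Ω (A ∪ B)) :
    mean (g * localDensity φ Q) = mean (g * localDensity φ (A ∪ B)) :=
  hφ.mean_mul_localDensity (union_subset hAQ hBQ)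
    (fun _ hM hMQ => hA.exists_eliminable_union hB hM ((card_le_card hMQ).trans hQ)) hg

/-- The variables in two tight sets are conditionally independent given those in their
intersection, so `w` is the conditional expectation of `v`. -/
lemma IsTight.exists_mean_mul_mul_localDensity (hφ : IsWiseDensity t N φ) (hA : IsTight t N b A)
    (hB : IsTight t N b B) (hAB : #(A ∪ B) ≤ b) {v : (V → Ω) → ℝ} (hv : v ∈ juntas Ω B) :
    ∃ w ∈ juntas Ω (A ∩ B), ∀ u ∈ juntas Ω A,
      mean (u * v * localDensity φ (A ∪ B)) = mean (u * w * localDensity φ A) := by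
  have hsep : IsSeparation t N A B (A ∪ B) A B :=
    hA.isSeparation hB subset_union_left subset_union_right hAB
      fun x hx hxA hxB => absurd hx (by simp [hxA, hxB])
  obtain ⟨G, hG, H, hH, hH0, hGH⟩ := hsep.exists_localDensity_eq_mul hφ
  set w := avg A (v * H) / avg A H
  have hw : w ∈ juntas Ω (A ∩ B) := fun x y hxy => congrArg₂ (· / ·)
    (avg_mem_juntas_inter (mul_mem hv hH) A hxy) (avg_mem_juntas_inter hH A hxy)
  have hwA : w ∈ juntas Ω A := juntas_mono inter_subset_left hw
  refine ⟨w, hw, fun u hu => ?_⟩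
  calc mean (u * v * localDensity φ (A ∪ B))
      = mean (u * G * (v * H)) := by rw [hGH, mul_mul_mul_comm]
    _ = mean (u * G * avg A (v * H)) := (mean_mul_avg (mul_mem hu hG) _).symm
    _ = mean (u * G * w * avg A H) := by rw [mul_assoc (u * G), avg_mul_div_avg_mul_avg hH0]
    _ = mean (u * G * w * H) := mean_mul_avg (mul_mem (mul_mem hu hG) hwA) _
    _ = mean (u * w * localDensity φ (A ∪ B)) := by rw [hGH, mul_right_comm u, mul_assoc]
    _ = mean (u * w * localDensity φ A) :=
        hA.mean_mul_localDensity hφ subset_union_left hAB (mul_mem hu hwA)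

lemma IsTightFamily.mean_mul_localDensity_union_eq (hφ : IsWiseDensity t N φ)
    (h𝓐 : IsTightFamily t N b 𝓐) (hA : A ∈ 𝓐) (hB : B ∈ 𝓐) (hC : C ∈ 𝓐) (hCA : C ⊆ A)
    {g h : (V → Ω) → ℝ} (hg : g ∈ juntas Ω C) (hh : h ∈ juntas Ω B) :
    mean (g * h * localDensity φ (A ∪ B)) = mean (g * h * localDensity φ (C ∪ B)) :=
  (h𝓐.isTight C hC).mean_mul_localDensity_union hφ (h𝓐.isTight B hB)
    (hCA.trans subset_union_left) subset_union_right (h𝓐.card_union_le A hA B hB)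
    (mul_mem (juntas_mono subset_union_left hg) (juntas_mono subset_union_right hh))

lemma IsTightFamily.gram_ite_ssubset (hφ : IsWiseDensity t N φ) (h𝓐 : IsTightFamily t N b 𝓐)
    (hA : A ∈ 𝓐) {l h : Finset V → (V → Ω) → ℝ} (hl : ∀ C, l C ∈ juntas Ω C)
    (hh : ∀ B, h B ∈ juntas Ω B) :
    gram φ 𝓐 (fun C => if C ⊂ A then l C else 0) h
      = gram φ 𝓐 (Pi.single A (∑ C ∈ 𝓐 with C ⊂ A, l C)) h := by
  have hcons : ∀ C ∈ 𝓐, C ⊂ A → ∀ B ∈ 𝓐,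
      mean (l C * h B * localDensity φ (A ∪ B)) = mean (l C * h B * localDensity φ (C ∪ B)) :=
    fun C hC hCA B hB => h𝓐.mean_mul_localDensity_union_eq hφ hA hB hC hCA.1 (hl C) (hh B)
  calc gram φ 𝓐 (fun C => if C ⊂ A then l C else 0) h
      = ∑ C ∈ 𝓐 with C ⊂ A, ∑ B ∈ 𝓐, mean (l C * h B * localDensity φ (C ∪ B)) := by
        rw [gram, sum_filter]
        refine sum_congr rfl fun C _ => ?_
        split_ifs <;> simp
    _ = ∑ C ∈ 𝓐 with C ⊂ A, ∑ B ∈ 𝓐, mean (l C * h B * localDensity φ (A ∪ B)) := by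
        refine sum_congr rfl fun C hC => sum_congr rfl fun B hB => ?_
        obtain ⟨hC, hCA⟩ := mem_filter.1 hC
        exact (hcons C hC hCA B hB).symm
    _ = gram φ 𝓐 (Pi.single A (∑ C ∈ 𝓐 with C ⊂ A, l C)) h := by
        rw [gram, sum_eq_single_of_mem A hA fun C _ hC => by simp [hC], sum_comm]
        simp only [Pi.single_eq_same, sum_mul, map_sum]

lemma IsTightFamily.mean_mul_mul_localDensity_eq_zero (hφ : IsWiseDensity t N φ)
    (h𝓐 : IsTightFamily t N b 𝓐) (hA : A ∈ 𝓐) (hmax : ∀ B ∈ 𝓐, A ⊆ B → B = A)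
    {u : (V → Ω) → ℝ} (hu : u ∈ juntas Ω A)
    (horth : ∀ C ∈ 𝓐, C ⊂ A → ∀ w ∈ juntas Ω C, mean (u * w * localDensity φ A) = 0)
    (hB : B ∈ 𝓐.erase A) {v : (V → Ω) → ℝ} (hv : v ∈ juntas Ω B) :
    mean (u * v * localDensity φ (A ∪ B)) = 0 := by
  obtain ⟨hBA, hB⟩ := mem_erase.1 hB
  obtain ⟨w, hw, huw⟩ := (h𝓐.isTight A hA).exists_mean_mul_mul_localDensity hφ
    (h𝓐.isTight B hB) (h𝓐.card_union_le A hA B hB) hv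
  rw [huw u hu]
  refine horth (A ∩ B) (h𝓐.inter_mem A hA B hB)
    (inter_subset_left.ssubset_of_ne fun h => hBA (hmax B hB (inter_eq_left.1 h))) w hw

theorem IsTightFamily.gram_self_nonneg (hφ : IsWiseDensity t N φ) (h𝓐 : IsTightFamily t N b 𝓐)
    {g : Finset V → (V → Ω) → ℝ} (hg : ∀ A, g A ∈ juntas Ω A) : 0 ≤ gram φ 𝓐 g g := by
  induction 𝓐 using Finset.strongInduction generalizing g with
  | H 𝓐 ih =>
    obtain rfl | hne := 𝓐.eq_empty_or_nonempty
    · simp [gram]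
    obtain ⟨A, hA, hmax⟩ := 𝓐.exists_maximal hne
    replace hmax : ∀ B ∈ 𝓐, A ⊆ B → B = A := fun B hB hAB => (hmax hB hAB).antisymm hAB
    obtain ⟨l, hl, horth⟩ := exists_juntas_forall_mean_sub_sum_mul_eq_zero
      (hφ.localDensity_nonneg A) {C ∈ 𝓐 | C ⊂ A} (g A)
    set s := ∑ C ∈ 𝓐 with C ⊂ A, l C
    have hs : s ∈ juntas Ω A := sum_mem fun C hC => juntas_mono (mem_filter.1 hC).2.1 (hl C)
    -- Adding `d` replaces `g A` by its component orthogonal to the functions of fewer variables.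
    set d : Finset V → (V → Ω) → ℝ := (fun C => if C ⊂ A then l C else 0) - Pi.single A s
    have hd : ∀ C, d C ∈ juntas Ω C := by
      intro C
      refine sub_mem ?_ ?_
      · dsimp only
        split_ifs
        exacts [hl C, zero_mem _]
      · obtain rfl | hCA := eq_or_ne C A
        · rwa [Pi.single_eq_same]
        · rw [Pi.single_eq_of_ne hCA]
          exact zero_mem _
    have gram_d {h : Finset V → (V → Ω) → ℝ} (hh : ∀ B, h B ∈ juntas Ω B) : gram φ 𝓐 d h = 0 := by
      rw [gram_sub_left, h𝓐.gram_ite_ssubset hφ hA hl hh, sub_self]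
    have hgd : ∀ B, (g + d) B ∈ juntas Ω B := fun B => add_mem (hg B) (hd B)
    have hgA : (g + d) A = g A - s := by simp [d, sub_eq_add_neg]
    have hcross : ∀ B ∈ 𝓐.erase A, mean ((g + d) A * (g + d) B * localDensity φ (A ∪ B)) = 0 :=
      fun B hB => h𝓐.mean_mul_mul_localDensity_eq_zero hφ hA hmax (hgd A)
        (fun C hC hCA w hw => hgA ▸ horth C (mem_filter.2 ⟨hC, hCA⟩) w hw) hB (hgd B)
    rw [← gram_add_self_of_gram_eq_zero (gram_d hg) (gram_d hd), gram_self_eq_add_gram_erase hA,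
      sum_eq_zero hcross, mul_zero, add_zero]
    refine add_nonneg (mean_nonneg fun x => ?_) (ih _ (erase_ssubset hA) (h𝓐.erase hmax) hgd)
    exact mul_nonneg (mul_self_nonneg _) (hφ.localDensity_nonneg A x)

end Positivity

/-! ### The pseudoexpectation defined by the local densities -/

section Evaluation

open MvPolynomial

variable {V Ω : Type*} {A B : Finset V}

/-- The algebra of polynomials in the indicators `X (i, c)` of the variables `i ∈ A`. -/
abbrev polysOn (Ω : Type*) (A : Finset V) : Subalgebra ℝ (MvPolynomial (V × Ω) ℝ) :=
  supported ℝ {p : V × Ω | p.1 ∈ A}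

lemma polysOn_mono (h : A ⊆ B) : polysOn Ω A ≤ polysOn Ω B :=
  supported_mono fun _ hp => h hp

lemma X_mem_polysOn {i : V} (hi : i ∈ A) (c : Ω) : X (i, c) ∈ polysOn Ω A :=
  X_mem_supported.2 hi

section MonomialVars

variable [DecidableEq V]

/-- The variables `i` for which an indicator `X (i, c)` occurs in the monomial with exponents
`e`. -/
def monomialVars (e : V × Ω →₀ ℕ) : Finset V :=
  e.support.image Prod.fst

lemma card_monomialVars_le (e : V × Ω →₀ ℕ) : #(monomialVars e) ≤ e.sum fun _ k => k := by
  refine card_image_le.trans ?_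
  rw [card_eq_sum_ones]
  exact sum_le_sum fun _ hi => Nat.one_le_iff_ne_zero.2 (Finsupp.mem_support_iff.1 hi)

lemma card_monomialVars_le_totalDegree {p : MvPolynomial (V × Ω) ℝ} {e : V × Ω →₀ ℕ}
    (he : e ∈ p.support) : #(monomialVars e) ≤ p.totalDegree :=
  (card_monomialVars_le e).trans (le_totalDegree he)

lemma monomial_mem_polysOn {e : V × Ω →₀ ℕ} (h : monomialVars e ⊆ A) (c : ℝ) :
    monomial e c ∈ polysOn Ω A := by
  refine mem_supported.2 fun p hp => ?_
  obtain ⟨d, hd, hpd⟩ := (mem_vars_iff_mem_support _).1 (mem_coe.1 hp)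
  rw [mem_singleton.1 (support_monomial_subset hd)] at hpd
  exact h (mem_image_of_mem _ hpd)

lemma monomialVars_subset {p : MvPolynomial (V × Ω) ℝ} (hp : p ∈ polysOn Ω A) {e : V × Ω →₀ ℕ}
    (he : e ∈ p.support) : monomialVars e ⊆ A :=
  image_subset_iff.2 fun _ hq => mem_supported.1 hp ((mem_vars_iff_mem_support _).2 ⟨e, he, hq⟩)

end MonomialVars

variable [DecidableEq Ω]

/-- The function on assignments that a polynomial in the indicators represents. -/
def evalFun : MvPolynomial (V × Ω) ℝ →ₐ[ℝ] ((V → Ω) → ℝ) :=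
  aeval fun p x => if x p.1 = p.2 then 1 else 0

lemma evalFun_X (i : V) (c : Ω) (x : V → Ω) : evalFun (X (i, c)) x = if x i = c then 1 else 0 := by
  rw [evalFun, aeval_X]

lemma evalFun_C (r : ℝ) (x : V → Ω) : evalFun (C r) x = r := by
  rw [evalFun, aeval_C, Pi.algebraMap_apply, Algebra.algebraMap_self_apply]

lemma evalFun_mem_juntas {p : MvPolynomial (V × Ω) ℝ} (hp : p ∈ polysOn Ω A) :
    evalFun p ∈ juntas Ω A := by
  suffices hle : polysOn Ω A ≤ (juntas Ω A).comap evalFun from hle hp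
  refine Algebra.adjoin_le ?_
  rintro _ ⟨⟨i, c⟩, hi, rfl⟩ x y hxy
  change evalFun (X (i, c)) x = evalFun (X (i, c)) y
  rw [evalFun_X, evalFun_X, hxy i hi]

end Evaluation

section Plausible

variable {V Ω F : Type*} [Fintype V] [DecidableEq V] [Fintype Ω] [Fintype F]
  {t : ℕ} {N : F → Finset V} {φ : F → (V → Ω) → ℝ} {η : ℝ} {b d D : ℕ} {A B M S : Finset V}

/-- The conditions under which the local densities define a pseudoexpectation of degree `D`: the
closure of a set of at most `D` variables has at most `b / 2` elements. -/
structure IsPlausible (t : ℕ) (N : F → Finset V) (φ : F → (V → Ω) → ℝ) (η : ℝ) (b D : ℕ) :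
    Prop where
  wise : IsWiseDensity t N φ
  expanding : IsExpanding t N η b
  pos : 0 < η
  le_one : η ≤ 1
  degree_le : 4 * (D : ℝ) ≤ η * b

/-- The tight sets whose weight is at most that of a set of `d` variables that lies in no
constraint. -/
def lightTightSets (t : ℕ) (N : F → Finset V) (b d : ℕ) : Finset (Finset V) :=
  open Classical in {A | IsTight t N b A ∧ #A ≤ b ∧ weight t N A ≤ 2 * d}

lemma mem_lightTightSets :
    A ∈ lightTightSets t N b d ↔ IsTight t N b A ∧ #A ≤ b ∧ weight t N A ≤ 2 * d := by
  simp [lightTightSets]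

lemma tightClosure_mem_lightTightSets (hS : #S ≤ b) (hd : #S ≤ d) :
    tightClosure t N b S ∈ lightTightSets t N b d := by
  refine mem_lightTightSets.2 ⟨isTight_tightClosure hS, card_tightClosure_le hS, ?_⟩
  have hclosure := weight_tightClosure_le (t := t) (N := N) (subset_refl S) hS
  have hweight := weight_le (t := t) (N := N) S
  omega

namespace IsPlausible

lemma four_mul_le (h : IsPlausible t N φ η b D) : 4 * D ≤ b := by
  have hb : η * b ≤ b := mul_le_of_le_one_left (Nat.cast_nonneg b) h.le_one
  exact_mod_cast h.degree_le.trans hb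

lemma weight_nonneg (h : IsPlausible t N φ η b D) (hM : #M ≤ b) : 0 ≤ weight t N M := by
  exact_mod_cast (mul_nonneg h.pos.le (Nat.cast_nonneg _)).trans (h.expanding M hM)

lemma two_mul_card_le (h : IsPlausible t N φ η b D) (hM : #M ≤ b) (hweight : weight t N M ≤ 2 * D) :
    2 * #M ≤ b := by
  have hexp := h.expanding M hM
  have hdeg := h.degree_le
  have hweight' : (weight t N M : ℝ) ≤ 2 * D := by exact_mod_cast hweight
  have hη : η * (2 * #M) ≤ η * b := by linarith
  exact_mod_cast le_of_mul_le_mul_left hη h.pos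

lemma two_mul_card_le_of_mem (h : IsPlausible t N φ η b D) (hA : A ∈ lightTightSets t N b d)
    (hd : d ≤ D) : 2 * #A ≤ b := by
  obtain ⟨-, hAb, hweight⟩ := mem_lightTightSets.1 hA
  exact h.two_mul_card_le hAb (by omega)

lemma card_union_le_of_mem (h : IsPlausible t N φ η b D) (hA : A ∈ lightTightSets t N b d)
    (hB : B ∈ lightTightSets t N b d) (hd : d ≤ D) : #(A ∪ B) ≤ b := by
  have hAb := h.two_mul_card_le_of_mem hA hd
  have hBb := h.two_mul_card_le_of_mem hB hd
  exact (card_union_le A B).trans (by omega)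

lemma isTight_inter (h : IsPlausible t N φ η b D) (hA : A ∈ lightTightSets t N b d)
    (hB : B ∈ lightTightSets t N b d) (hd : d ≤ D) (hweight : weight t N (A ∩ B) ≤ 2 * D) :
    IsTight t N b (A ∩ B) := by
  have hAB : #(A ∩ B) ≤ b :=
    (card_le_card inter_subset_left).trans (mem_lightTightSets.1 hA).2.1
  have hclosure := h.two_mul_card_le (card_tightClosure_le (t := t) (N := N) hAB)
    ((weight_tightClosure_le subset_rfl hAB).trans hweight)
  have hsub {C : Finset V} (hC : C ∈ lightTightSets t N b d) (hABC : A ∩ B ⊆ C) :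
      tightClosure t N b (A ∩ B) ⊆ C := by
    refine tightClosure_subset (mem_lightTightSets.1 hC).1 hABC ((card_union_le _ _).trans ?_)
    have := h.two_mul_card_le_of_mem hC hd
    omega
  rw [← (subset_inter (hsub hA inter_subset_left) (hsub hB inter_subset_right)).antisymm
    (subset_tightClosure _)]
  exact isTight_tightClosure hAB

lemma isTightFamily (h : IsPlausible t N φ η b D) (hd : d ≤ D) :
    IsTightFamily t N b (lightTightSets t N b d) where
  isTight A hA := (mem_lightTightSets.1 hA).1
  card_union_le A hA B hB := h.card_union_le_of_mem hA hB hd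
  inter_mem A hA B hB := by
    obtain ⟨hAt, hAb, -⟩ := mem_lightTightSets.1 hA
    have hBw := (mem_lightTightSets.1 hB).2.2
    have hunion : weight t N A ≤ weight t N (A ∪ B) := by
      obtain heq | hss := (subset_union_left : A ⊆ A ∪ B).eq_or_ssubset
      · rw [← heq]
      · exact (hAt _ hss (h.card_union_le_of_mem hA hB hd)).le
    have hsubmod := weight_union_add_weight_inter (t := t) (N := N) A B
    have hweight : weight t N (A ∩ B) ≤ 2 * d := by linarith
    exact mem_lightTightSets.2 ⟨h.isTight_inter hA hB hd (by omega),
      (card_le_card inter_subset_left).trans hAb, hweight⟩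

lemma isTight_empty (h : IsPlausible t N φ η b D) : IsTight t N b ∅ := by
  intro X hX hXb
  have hpos : 0 < η * #X :=
    mul_pos h.pos (Nat.cast_pos.2 (card_pos.2 (empty_ssubset.1 hX)))
  rw [weight_empty]
  exact_mod_cast hpos.trans_le (h.expanding X hXb)

end IsPlausible

end Plausible

section Pseudoexpectation

open MvPolynomial

variable {V Ω F : Type*} [Fintype V] [DecidableEq V] [Fintype F] {t : ℕ} {N : F → Finset V}
  {φ : F → (V → Ω) → ℝ} {η : ℝ} {b d D : ℕ} {A B : Finset V}

/-- The part of a polynomial made of the monomials whose variables have closure `A`. -/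
def tightPart (t : ℕ) (N : F → Finset V) (b : ℕ) (p : MvPolynomial (V × Ω) ℝ) (A : Finset V) :
    MvPolynomial (V × Ω) ℝ :=
  ∑ e ∈ p.support with tightClosure t N b (monomialVars e) = A, monomial e (p.coeff e)

lemma tightPart_mem_polysOn (p : MvPolynomial (V × Ω) ℝ) (A : Finset V) :
    tightPart t N b p A ∈ polysOn Ω A :=
  sum_mem fun _ he => monomial_mem_polysOn ((mem_filter.1 he).2 ▸ subset_tightClosure _) _

lemma totalDegree_tightPart_le (p : MvPolynomial (V × Ω) ℝ) (A : Finset V) :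
    (tightPart t N b p A).totalDegree ≤ p.totalDegree :=
  totalDegree_finsetSum_le fun _ he =>
    (totalDegree_monomial_le _ _).trans (le_totalDegree (mem_filter.1 he).1)

lemma sum_tightPart {p : MvPolynomial (V × Ω) ℝ} (hpb : p.totalDegree ≤ b) :
    ∑ A ∈ lightTightSets t N b p.totalDegree, tightPart t N b p A = p := by
  conv_rhs => rw [p.as_sum]
  refine sum_fiberwise_of_maps_to (g := fun e => tightClosure t N b (monomialVars e))
    (fun e he => ?_) fun e => monomial e (p.coeff e)
  have hvars := card_monomialVars_le_totalDegree he
  exact tightClosure_mem_lightTightSets (hvars.trans hpb) hvars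

variable [Fintype Ω] [DecidableEq Ω]

/-- The linear functional that takes the expectation of each monomial with respect to the local
density on the closure of its set of variables. -/
def pseudoExp (t : ℕ) (N : F → Finset V) (φ : F → (V → Ω) → ℝ) (b : ℕ) :
    MvPolynomial (V × Ω) ℝ →ₗ[ℝ] ℝ :=
  (basisMonomials _ ℝ).constr ℝ fun e =>
    mean (evalFun (monomial e 1) * localDensity φ (tightClosure t N b (monomialVars e)))

lemma pseudoExp_monomial (e : V × Ω →₀ ℕ) (c : ℝ) :
    pseudoExp t N φ b (monomial e c) =
      mean (evalFun (monomial e c) * localDensity φ (tightClosure t N b (monomialVars e))) := by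
  have hbasis := (basisMonomials (V × Ω) ℝ).constr_basis ℝ (fun e =>
    mean (evalFun (monomial e 1) * localDensity φ (tightClosure t N b (monomialVars e)))) e
  rw [coe_basisMonomials] at hbasis
  rw [← mul_one c, ← smul_eq_mul, ← smul_monomial, map_smul, map_smul, smul_mul_assoc, map_smul]
  exact congrArg (c • ·) hbasis

namespace IsPlausible

variable [Nonempty Ω]

lemma pseudoExp_eq (h : IsPlausible t N φ η b D) (hA : A ∈ lightTightSets t N b D)
    {p : MvPolynomial (V × Ω) ℝ} (hp : p ∈ polysOn Ω A) (hdeg : p.totalDegree ≤ D) :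
    pseudoExp t N φ b p = mean (evalFun p * localDensity φ A) := by
  rw [p.as_sum, map_sum, map_sum, sum_mul, map_sum]
  refine sum_congr rfl fun e he => ?_
  have hvars := (card_monomialVars_le_totalDegree he).trans hdeg
  have hb : #(monomialVars e) ≤ b := by have := h.four_mul_le; omega
  have hsub : tightClosure t N b (monomialVars e) ⊆ A :=
    tightClosure_subset (mem_lightTightSets.1 hA).1 (monomialVars_subset hp he)
      (h.card_union_le_of_mem (tightClosure_mem_lightTightSets hb hvars) hA le_rfl)
  rw [pseudoExp_monomial]
  exact ((isTight_tightClosure hb).mean_mul_localDensity h.wise hsub (mem_lightTightSets.1 hA).2.1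
    (evalFun_mem_juntas (monomial_mem_polysOn (subset_tightClosure _) _))).symm

lemma pseudoExp_eq_union (h : IsPlausible t N φ η b D) (hA : A ∈ lightTightSets t N b d)
    (hB : B ∈ lightTightSets t N b d) (hd : 2 * d ≤ D) {p : MvPolynomial (V × Ω) ℝ}
    (hp : p ∈ polysOn Ω (A ∪ B)) (hdeg : p.totalDegree ≤ D) :
    pseudoExp t N φ b p = mean (evalFun p * localDensity φ (A ∪ B)) := by
  obtain ⟨hAt, hAb, hAw⟩ := mem_lightTightSets.1 hA
  obtain ⟨hBt, -, hBw⟩ := mem_lightTightSets.1 hB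
  have hunion := h.card_union_le_of_mem hA hB (by omega)
  have hsub := subset_tightClosure (t := t) (N := N) (b := b) (A ∪ B)
  have hclosure : tightClosure t N b (A ∪ B) ∈ lightTightSets t N b D := by
    refine mem_lightTightSets.2 ⟨isTight_tightClosure hunion, card_tightClosure_le hunion, ?_⟩
    have hsubmod := weight_union_add_weight_inter (t := t) (N := N) A B
    have hinter := h.weight_nonneg ((card_le_card (inter_subset_left (s₂ := B))).trans hAb)
    have hmin := weight_tightClosure_le (t := t) (N := N) (subset_refl (A ∪ B)) hunion
    omega
  rw [h.pseudoExp_eq hclosure (polysOn_mono hsub hp) hdeg]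
  exact hAt.mean_mul_localDensity_union h.wise hBt (subset_union_left.trans hsub)
    (subset_union_right.trans hsub) (card_tightClosure_le hunion) (evalFun_mem_juntas hp)

lemma pseudoExp_one (h : IsPlausible t N φ η b D) : pseudoExp t N φ b 1 = 1 := by
  have hempty : ∅ ∈ lightTightSets t N b D :=
    mem_lightTightSets.2 ⟨h.isTight_empty, by simp, by simp⟩
  have hdensity : localDensity φ ∅ = 1 :=
    prod_eq_one fun f _ => h.wise.avg_eq_one f ∅ (by simp)
  rw [h.pseudoExp_eq hempty (one_mem _) (by simp), map_one, one_mul, hdensity]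
  exact mean_const 1

lemma pseudoExp_sq_nonneg (h : IsPlausible t N φ η b D) (p : MvPolynomial (V × Ω) ℝ)
    (hp : 2 * p.totalDegree ≤ D) : 0 ≤ pseudoExp t N φ b (p ^ 2) := by
  set 𝓐 := lightTightSets t N b p.totalDegree
  set q := tightPart t N b p
  have hq : ∀ A, q A ∈ polysOn Ω A := tightPart_mem_polysOn p
  have hmul : ∀ A ∈ 𝓐, ∀ B ∈ 𝓐, pseudoExp t N φ b (q A * q B)
      = mean (evalFun (q A) * evalFun (q B) * localDensity φ (A ∪ B)) := by
    intro A hA B hB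
    have hdeg : (q A * q B).totalDegree ≤ D := by
      refine (totalDegree_mul _ _).trans (le_trans ?_ hp)
      rw [two_mul]
      exact add_le_add (totalDegree_tightPart_le p A) (totalDegree_tightPart_le p B)
    rw [← map_mul]
    exact h.pseudoExp_eq_union hA hB hp (mul_mem (polysOn_mono subset_union_left (hq A))
      (polysOn_mono subset_union_right (hq B))) hdeg
  have hgram : pseudoExp t N φ b (p ^ 2) = gram φ 𝓐 (fun A => evalFun (q A)) fun A =>
      evalFun (q A) := by
    have hb : p.totalDegree ≤ b := by have := h.four_mul_le; omega
    conv_lhs => rw [← sum_tightPart (t := t) (N := N) hb, sq, sum_mul_sum]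
    simp only [map_sum]
    exact sum_congr rfl fun A hA => sum_congr rfl (hmul A hA)
  rw [hgram]
  exact (h.isTightFamily (by omega)).gram_self_nonneg h.wise fun A => evalFun_mem_juntas (hq A)

lemma pseudoExp_mul_eq_zero (h : IsPlausible t N φ η b D) {i : V} {q r : MvPolynomial (V × Ω) ℝ}
    (hq : q ∈ polysOn Ω {i}) (hq0 : evalFun q = 0) (hdeg : 1 ≤ q.totalDegree)
    (hqr : q.totalDegree + r.totalDegree ≤ D) : pseudoExp t N φ b (q * r) = 0 := by
  rw [r.as_sum, mul_sum, map_sum]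
  refine sum_eq_zero fun e he => ?_
  have hvars : #(insert i (monomialVars e)) ≤ D := by
    have hinsert := card_insert_le i (monomialVars e)
    have hmonomial := card_monomialVars_le_totalDegree he
    omega
  have hb : D ≤ b := by have := h.four_mul_le; omega
  have hclosure := tightClosure_mem_lightTightSets (t := t) (N := N) (hvars.trans hb) hvars
  have hsub := subset_tightClosure (t := t) (N := N) (b := b) (insert i (monomialVars e))
  have hqmem := polysOn_mono ((singleton_subset_iff.2 (mem_insert_self i _)).trans hsub) hq
  have hmonomial := monomial_mem_polysOn ((subset_insert i (monomialVars e)).trans hsub) (r.coeff e)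
  have hdeg' : (q * monomial e (r.coeff e)).totalDegree ≤ D :=
    (totalDegree_mul _ _).trans ((Nat.add_le_add_left
      ((totalDegree_monomial_le e _).trans (le_totalDegree he)) _).trans hqr)
  have heval : evalFun (q * monomial e (r.coeff e)) = 0 := by rw [map_mul evalFun, hq0, zero_mul]
  rw [h.pseudoExp_eq hclosure (mul_mem hqmem hmonomial) hdeg', heval, zero_mul, map_zero]

lemma satisfiesIdentity (h : IsPlausible t N φ η b D) {i : V} {q : MvPolynomial (V × Ω) ℝ}
    (hq : q ∈ polysOn Ω {i}) (hq0 : evalFun q = 0) :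
    SatisfiesIdentity D (pseudoExp t N φ b) q := by
  intro r hr
  obtain rfl | hqne := eq_or_ne q 0
  · rw [zero_mul, map_zero]
  obtain rfl | hrne := eq_or_ne r 0
  · rw [mul_zero, map_zero]
  have hdeg : q.totalDegree ≠ 0 := by
    intro hdeg
    rw [totalDegree_eq_zero_iff_eq_C] at hdeg
    have hcoeff : q.coeff 0 = 0 := by
      rw [← evalFun_C (q.coeff 0) (Classical.arbitrary (V → Ω)), ← hdeg, hq0, Pi.zero_apply]
    exact hqne (by rw [hdeg, hcoeff, C_0])
  rw [totalDegree_mul_of_isDomain hqne hrne] at hr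
  exact h.pseudoExp_mul_eq_zero hq hq0 (Nat.one_le_iff_ne_zero.2 hdeg) hr

theorem isAssignmentPseudoexpectation {n : ℕ} {N : F → Finset (Fin n)}
    {φ : F → (Fin n → Ω) → ℝ} (h : IsPlausible t N φ η b D) :
    IsAssignmentPseudoexpectation D (pseudoExp t N φ b) where
  map_one := h.pseudoExp_one
  sq_nonneg := h.pseudoExp_sq_nonneg
  sum_eq_one i := by
    refine h.satisfiesIdentity (i := i) (sub_mem (sum_mem fun c _ =>
      X_mem_polysOn (mem_singleton_self i) c) (one_mem _)) ?_
    ext x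
    simp [evalFun_X]
  sq_eq_self i c := by
    have hX := X_mem_polysOn (mem_singleton_self i) c
    refine h.satisfiesIdentity (i := i) (sub_mem (pow_mem hX 2) hX) ?_
    ext x
    simp [evalFun_X]

end IsPlausible

end Pseudoexpectation

/-! ### Constraints -/

section Constraint

variable {n k : ℕ} {Ω : Type*} {L : Finset (Equiv.Perm Ω)}

/-- The set of variables of a constraint. -/
def Constraint.scope (c : Constraint n k L) : Finset (Fin n) :=
  univ.map c.1

/-- The values of the literals of a constraint under an assignment. -/
def Constraint.read (c : Constraint n k L) (x : Fin n → Ω) : Fin k → Ω :=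
  fun j => (c.2 j : Equiv.Perm Ω) (x (c.1 j))

lemma Constraint.card_scope (c : Constraint n k L) : #(Constraint.scope c) = k := by
  simp only [Constraint.scope, card_map, card_univ, Fintype.card_fin]

lemma Constraint.mem_scope (c : Constraint n k L) (j : Fin k) : c.1 j ∈ Constraint.scope c :=
  mem_map_of_mem _ (mem_univ j)

lemma Constraint.comp_read_mem_juntas (c : Constraint n k L) (G : (Fin k → Ω) → ℝ) :
    (fun x => G (Constraint.read c x)) ∈ juntas Ω (Constraint.scope c) := fun _ _ hxy =>
  congrArg G (funext fun j => congrArg (c.2 j : Equiv.Perm Ω) (hxy _ (Constraint.mem_scope c j)))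

variable [Fintype Ω] [Nonempty Ω]

lemma Constraint.mean_read (c : Constraint n k L) (G : (Fin k → Ω) → ℝ) :
    mean (fun x => G (Constraint.read c x)) = mean G := by
  let put (y : Fin k → Ω) (x : Fin n → Ω) : Fin n → Ω :=
    Function.extend c.1 (fun j => (c.2 j : Equiv.Perm Ω).symm (y j)) x
  have read_put (x y) : Constraint.read c (put y x) = y := by
    ext j
    simp [Constraint.read, put, c.1.injective.extend_apply]
  have put_read (x y) : put (Constraint.read c x) (put y x) = x := by
    ext i
    by_cases hi : ∃ j, c.1 j = i
    · obtain ⟨j, rfl⟩ := hi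
      simp [Constraint.read, put, c.1.injective.extend_apply]
    · simp [put, Function.extend_apply' _ _ _ hi]
  have hswap : Function.Involutive fun p : (Fin n → Ω) × (Fin k → Ω) =>
      (put p.2 p.1, Constraint.read c p.1) := fun p => by simp [read_put, put_read]
  calc 𝔼 x, G (Constraint.read c x)
      = 𝔼 p : (Fin n → Ω) × (Fin k → Ω), G (Constraint.read c p.1) := by
        rw [← univ_product_univ, expect_product]
        exact expect_congr rfl fun x _ => (Fintype.expect_const _).symm
    _ = 𝔼 p : (Fin n → Ω) × (Fin k → Ω), G p.2 :=
        Fintype.expect_equiv hswap.toPerm _ (fun p => G p.2) fun _ => rfl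
    _ = 𝔼 y, G y := by
        rw [← univ_product_univ, expect_product]
        exact Fintype.expect_const (ι := Fin n → Ω) (𝔼 y, G y)

lemma Constraint.avg_read (c : Constraint n k L) (G : (Fin k → Ω) → ℝ) (A : Finset (Fin n))
    (x : Fin n → Ω) : avg A (fun x => G (Constraint.read c x)) x =
      avg {j | c.1 j ∈ A} G (Constraint.read c x) := by
  have read_piecewise (y) : Constraint.read c (A.piecewise x y) =
      Finset.piecewise {j | c.1 j ∈ A} (Constraint.read c x) (Constraint.read c y) := by
    ext j
    by_cases hj : c.1 j ∈ A <;> simp [Constraint.read, hj]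
  simp only [avg, read_piecewise]
  exact Constraint.mean_read c fun z =>
    G (Finset.piecewise {j | c.1 j ∈ A} (Constraint.read c x) z)

end Constraint

section WiseUniform

variable {V Ω : Type*} [Fintype V] [DecidableEq V] [Fintype Ω] [DecidableEq Ω]

lemma card_filter_forall_mem_eq (T : Finset V) (a : V → Ω) :
    #{y : V → Ω | ∀ i : T, y i = a i} = Fintype.card Ω ^ (Fintype.card V - #T) := by
  have hpi : ({y | ∀ i : T, y i = a i} : Finset (V → Ω)) =
      Fintype.piFinset fun i => if i ∈ T then {a i} else univ := by
    ext y
    simp only [mem_filter_univ, Fintype.mem_piFinset, Subtype.forall]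
    exact forall_congr' fun i => by split_ifs with hi <;> simp [hi]
  rw [hpi, Fintype.card_piFinset]
  simp only [apply_ite card, card_singleton, card_univ, prod_ite, prod_const_one, one_mul,
    prod_const]
  rw [← card_compl, compl_eq_univ_sdiff, sdiff_eq_filter]

variable [Nonempty Ω]

lemma sum_filter_forall_mem_eq (T : Finset V) (a : V → Ω) (g : (V → Ω) → ℝ) :
    ∑ y with (∀ i : T, y i = a i), g y = #{y : V → Ω | ∀ i : T, y i = a i} * avg T g a := by
  set χ : (V → Ω) → ℝ := fun y => if ∀ i : T, y i = a i then 1 else 0 with hχ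
  have hjunta : χ ∈ juntas Ω T := fun x y hxy => by
    have : (∀ i : T, x i = a i) ↔ ∀ i : T, y i = a i :=
      forall_congr' fun i => by rw [hxy i i.2]
    simp only [hχ, this]
  have havg : χ * avg T g = χ * fun _ => avg T g a := by
    ext y
    by_cases hy : ∀ i : T, y i = a i
    · exact congrArg (χ y * ·) (avg_mem_juntas T g fun i hi => hy ⟨i, hi⟩)
    · simp only [Pi.mul_apply, hχ, if_neg hy, zero_mul]
  have hmean : mean (χ * g) = mean (χ * fun _ => avg T g a) := by
    rw [← havg, mean_mul_avg hjunta]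
  simp only [mean_apply, Fintype.expect_eq_sum_div_card, Pi.mul_apply] at hmean
  rw [div_left_inj' (Nat.cast_ne_zero.2 Fintype.card_ne_zero), ← sum_mul] at hmean
  simpa only [hχ, ite_mul, one_mul, zero_mul, sum_boole, ← sum_filter] using hmean

lemma IsWiseUniform.avg_eq {k t : ℕ} (htk : t ≤ k) {μ : (Fin k → Ω) → ℝ} (hμ : IsWiseUniform t μ)
    {T : Finset (Fin k)} (hT : #T ≤ t) :
    avg T μ = fun _ => (Fintype.card (Fin k → Ω) : ℝ)⁻¹ := by
  obtain ⟨T', hTT', rfl⟩ := exists_superset_card_eq hT (by simpa using htk)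
  have hconst : avg T' μ = fun _ => (Fintype.card (Fin k → Ω) : ℝ)⁻¹ := by
    ext a
    have hq : (Fintype.card Ω : ℝ) ≠ 0 := Nat.cast_ne_zero.2 Fintype.card_ne_zero
    have hsum := (sum_filter_forall_mem_eq T' a μ).symm.trans (hμ T' rfl fun i => a i)
    rw [card_filter_forall_mem_eq, Fintype.card_fin, Nat.cast_pow] at hsum
    rw [Fintype.card_fun, Fintype.card_fin, Nat.cast_pow,
      (eq_inv_mul_iff_mul_eq₀ (pow_ne_zero _ hq)).2 hsum, ← mul_inv, ← pow_add,
      Nat.sub_add_cancel htk]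
  rw [← inter_eq_left.2 hTT', ← avg_avg, hconst]
  exact avg_of_mem_juntas fun _ _ _ => rfl

end WiseUniform

section ConstraintDensity

variable {n k : ℕ} {Ω : Type*} {L : Finset (Equiv.Perm Ω)} [Fintype Ω]

/-- The density, relative to the uniform distribution on assignments, of the distribution `μ` on
the values of the literals of a constraint. -/
def Constraint.density (μ : (Fin k → Ω) → ℝ) (c : Constraint n k L) (x : Fin n → Ω) : ℝ :=
  Fintype.card (Fin k → Ω) * μ (Constraint.read c x)

/-- The variables of the constraints of an instance. -/
abbrev CSPInstance.scopes {m : ℕ} (I : CSPInstance n m k L) (f : Fin m) : Finset (Fin n) :=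
  Constraint.scope (I f)

/-- The densities planted by `μ` on the constraints of an instance. -/
abbrev CSPInstance.densities {m : ℕ} (I : CSPInstance n m k L) (μ : (Fin k → Ω) → ℝ) (f : Fin m) :
    (Fin n → Ω) → ℝ :=
  Constraint.density μ (I f)

variable [DecidableEq Ω]

lemma IsWiseUniform.isWiseDensity [Nonempty Ω] {m t : ℕ} (htk : t ≤ k)
    {μ : (Fin k → Ω) → ℝ} (hμ : IsWiseUniform t μ) (hμ0 : ∀ x, 0 ≤ μ x)
    (I : CSPInstance n m k L) : IsWiseDensity t I.scopes (I.densities μ) where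
  nonneg f x := mul_nonneg (Nat.cast_nonneg _) (hμ0 _)
  mem_juntas f := Constraint.comp_read_mem_juntas (I f) fun y => Fintype.card (Fin k → Ω) * μ y
  avg_eq_one f A hA := by
    have hcard : #{j | (I f).1 j ∈ A} ≤ t := by
      rw [CSPInstance.scopes, Constraint.scope, ← filter_mem_eq_inter, filter_map, card_map] at hA
      exact hA
    ext x
    calc avg A (Constraint.density μ (I f)) x
        = avg {j | (I f).1 j ∈ A} (fun y => Fintype.card (Fin k → Ω) * μ y)
            (Constraint.read (I f) x) :=
          Constraint.avg_read (I f) (fun y => Fintype.card (Fin k → Ω) * μ y) A x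
      _ = Fintype.card (Fin k → Ω) * avg {j | (I f).1 j ∈ A} μ (Constraint.read (I f) x) :=
          (mul_expect _ _ _).symm
      _ = 1 := by
          rw [hμ.avg_eq htk hcard, mul_inv_cancel₀ (Nat.cast_ne_zero.2 Fintype.card_ne_zero)]

end ConstraintDensity

section ConstraintPoly

variable {n k : ℕ} {Ω : Type*} [Fintype Ω] [DecidableEq Ω] {L : Finset (Equiv.Perm Ω)}

lemma evalFun_poly (P : (Fin k → Ω) → Bool) (c : Constraint n k L) (x : Fin n → Ω) :
    evalFun (Constraint.poly P c) x = if P (Constraint.read c x) = true then 1 else 0 := by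
  have evalFun_prod (a : Fin k → Ω) : evalFun (∏ j, MvPolynomial.X (c.1 j, a j)) x =
      if (fun j => x (c.1 j)) = a then 1 else 0 := by
    simp only [map_prod, Finset.prod_apply, evalFun_X, prod_ite_zero, prod_const_one, mem_univ,
      true_imp_iff, funext_iff]
  rw [Constraint.poly, map_sum, Finset.sum_apply]
  simp only [evalFun_prod, sum_ite_eq, mem_filter_univ]
  rfl

lemma poly_mem_polysOn (P : (Fin k → Ω) → Bool) (c : Constraint n k L) :
    Constraint.poly P c ∈ polysOn Ω (Constraint.scope c) :=
  sum_mem fun _ _ => prod_mem fun j _ => X_mem_polysOn (Constraint.mem_scope c j) _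

lemma totalDegree_poly_le (P : (Fin k → Ω) → Bool) (c : Constraint n k L) :
    (Constraint.poly P c).totalDegree ≤ k :=
  MvPolynomial.totalDegree_finsetSum_le fun a _ =>
    (MvPolynomial.totalDegree_finsetProd _ _).trans (by simp)

end ConstraintPoly

section TotalVariation

variable {α : Type*} [Fintype α]

lemma one_sub_tvDist_le {P : α → Bool} {μ σ : α → ℝ} (hμ : μ ∈ stdSimplex ℝ α)
    (hσ : σ ∈ stdSimplex ℝ α) (hP : ∀ x, P x = false → σ x = 0) :
    1 - tvDist μ σ ≤ ∑ x, if P x = true then μ x else 0 := by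
  have hpoint (x) : σ x - (if P x = true then μ x else 0) ≤
      (1 / 2) * (|μ x - σ x| + (σ x - μ x)) := by
    split_ifs with h
    · have := neg_le_abs (μ x - σ x)
      linarith
    · rw [hP x (by simpa using h)]
      have := le_abs_self (μ x - 0)
      linarith
  have hsum := sum_le_sum fun x (_ : x ∈ univ) => hpoint x
  rw [sum_sub_distrib, ← mul_sum, sum_add_distrib, sum_sub_distrib, hσ.2, hμ.2] at hsum
  unfold tvDist
  linarith

lemma tvDist_nonneg (μ σ : α → ℝ) : 0 ≤ tvDist μ σ :=
  mul_nonneg (by norm_num) (sum_nonneg fun _ _ => abs_nonneg _)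

end TotalVariation

/-! ### The value of the pseudoexpectation -/

section Isolated

variable {V F : Type*} [DecidableEq V] {t b : ℕ} {N : F → Finset V} {f : F}

lemma excess_self (hk : t + 1 ≤ 2 * #(N f)) : excess t N (N f) f = 2 * #(N f) - (t + 1) := by
  rw [excess, inter_self]
  omega

lemma not_eliminable_sdiff {A M : Finset V}
    (h : ∀ g, t < #(N g ∩ M) → min #(N g ∩ A) #(N g ∩ (M \ A)) = 0) {v : V} (hv : v ∈ M \ A)
    (hvM : ¬ Eliminable t N M v) : ¬ Eliminable t N (M \ A) v := by
  have hinter (g) (hvg : v ∈ N g) (hg : t < #(N g ∩ M)) : t < #(N g ∩ (M \ A)) := by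
    have hpos : 0 < #(N g ∩ (M \ A)) := card_pos.2 ⟨v, mem_inter.2 ⟨hvg, hv⟩⟩
    have hmin := h g hg
    have hdisj : Disjoint (N g) A := disjoint_iff_inter_eq_empty.2 (card_eq_zero.1 (by omega))
    rwa [← inter_sdiff_assoc, sdiff_eq_self_of_disjoint (hdisj.mono_left inter_subset_left)]
  exact fun helim => hvM fun g g' hg hg' hgM hgM' =>
    helim g g' hg hg' (hinter g hg hgM) (hinter g' hg' hgM')

variable [Fintype F]

/-- All small sets containing the variables of `f` have weight more than `t`. The variables of
such an `f` are then a tight set on which only `f` itself has a nontrivial marginal density. -/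
def IsIsolated (t : ℕ) (N : F → Finset V) (b : ℕ) (f : F) : Prop :=
  ∀ M, N f ⊆ M → #M ≤ b → (t + 1 : ℤ) ≤ weight t N M

lemma weight_self_le (hk : t + 1 ≤ 2 * #(N f)) : weight t N (N f) ≤ t + 1 := by
  have hself := single_le_sum (fun g _ => excess_nonneg g) (mem_univ f) (f := excess t N (N f))
  rw [excess_self hk] at hself
  unfold weight
  linarith

lemma IsIsolated.card_inter_le {g : F} (h : IsIsolated t N b f) (hb : #(N f) ≤ b)
    (hk : t + 1 ≤ 2 * #(N f)) (hgf : g ≠ f) : #(N g ∩ N f) ≤ t := by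
  classical
  have hpair : excess t N (N f) g + excess t N (N f) f ≤ ∑ g, excess t N (N f) g := by
    rw [← sum_pair hgf]
    exact sum_le_univ_sum_of_nonneg excess_nonneg
  have hweight := h (N f) subset_rfl hb
  rw [weight] at hweight
  rw [excess_self hk, excess] at hpair
  omega

lemma IsIsolated.exists_eliminable {η : ℝ} (h : IsIsolated t N b f) (hexp : IsExpanding t N η b)
    (hη : 0 < η) (hk : t + 1 ≤ 2 * #(N f)) {M : Finset V} (hM : N f ⊂ M) (hMb : #M ≤ b) :
    ∃ v ∈ M \ N f, Eliminable t N M v := by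
  by_contra! hnone
  have hsum : ∑ g with t < #(N g ∩ M), (min #(N g ∩ N f) #(N g ∩ (M \ N f)) : ℤ) ≤ 0 := by
    linarith [weight_add_sum_min_le hM.1 hnone, h M hM.1 hMb, weight_self_le hk]
  have hmin (g) (hg : t < #(N g ∩ M)) : min #(N g ∩ N f) #(N g ∩ (M \ N f)) = 0 := by
    have hle := (single_le_sum (fun g _ => by positivity) (mem_filter_univ g |>.2 hg)).trans hsum
    omega
  have hweight : weight t N (M \ N f) ≤ 0 := weight_empty (N := N) ▸
    weight_le_weight_of_forall_not_eliminable (empty_subset _) fun v hv =>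
      have hvM : v ∈ M \ N f := (Finset.mem_sdiff.1 hv).1
      not_eliminable_sdiff hmin hvM (hnone v hvM)
  have hexpand := hexp (M \ N f) ((card_le_card sdiff_subset).trans hMb)
  have hpos : 0 < η * #(M \ N f) :=
    mul_pos hη (Nat.cast_pos.2 (card_pos.2 (sdiff_nonempty.2 hM.2)))
  exact (hpos.trans_le hexpand).not_ge (Int.cast_nonpos.2 hweight)

end Isolated

section Planted

variable {n m k t : ℕ} {Ω : Type*} [Fintype Ω] [Nonempty Ω] {L : Finset (Equiv.Perm Ω)}
  {μ : (Fin k → Ω) → ℝ} {η : ℝ} {b D : ℕ} {I : CSPInstance n m k L}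

lemma IsIsolated.localDensity_scope {f : Fin m} (hf : IsIsolated t I.scopes b f)
    (hwise : IsWiseDensity t I.scopes (I.densities μ)) (hkb : k ≤ b) (htk : t + 1 ≤ 2 * k) :
    localDensity (I.densities μ) (I.scopes f) = I.densities μ f := by
  have hcard : #(I.scopes f) = k := Constraint.card_scope (I f)
  refine (prod_eq_single f (fun g _ hgf => ?_) (by simp)).trans
    (avg_of_mem_juntas (hwise.mem_juntas f))
  exact hwise.avg_eq_one g _ (hf.card_inter_le (hcard.trans_le hkb) (by omega) hgf)

variable [DecidableEq Ω]

lemma pseudoExp_poly (h : IsPlausible t I.scopes (I.densities μ) η b D) (hkD : k ≤ D)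
    (P : (Fin k → Ω) → Bool) (f : Fin m) :
    pseudoExp t I.scopes (I.densities μ) b (Constraint.poly P (I f)) =
      mean (evalFun (Constraint.poly P (I f)) *
        localDensity (I.densities μ) (tightClosure t I.scopes b (I.scopes f))) := by
  have hcard : #(I.scopes f) = k := Constraint.card_scope (I f)
  have hb := h.four_mul_le
  exact h.pseudoExp_eq (tightClosure_mem_lightTightSets (by omega) (by omega))
    (polysOn_mono (subset_tightClosure _) (poly_mem_polysOn P (I f)))
    ((totalDegree_poly_le P (I f)).trans hkD)

lemma pseudoExp_poly_nonneg (h : IsPlausible t I.scopes (I.densities μ) η b D) (hkD : k ≤ D)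
    (P : (Fin k → Ω) → Bool) (f : Fin m) :
    0 ≤ pseudoExp t I.scopes (I.densities μ) b (Constraint.poly P (I f)) := by
  rw [pseudoExp_poly h hkD]
  refine mean_nonneg fun x => mul_nonneg ?_ (h.wise.localDensity_nonneg _ x)
  rw [evalFun_poly]
  positivity

lemma mean_evalFun_poly_mul_density (P : (Fin k → Ω) → Bool) (c : Constraint n k L) :
    mean (evalFun (Constraint.poly P c) * Constraint.density μ c) =
      ∑ y, if P y = true then μ y else 0 := by
  have hread : evalFun (Constraint.poly P c) * Constraint.density μ c = fun x =>
      (fun y => (if P y = true then (1 : ℝ) else 0) * (Fintype.card (Fin k → Ω) * μ y))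
        (Constraint.read c x) := by
    ext x
    rw [Pi.mul_apply, evalFun_poly, Constraint.density]
  rw [hread, Constraint.mean_read c fun y => (if P y = true then (1 : ℝ) else 0) *
    (Fintype.card (Fin k → Ω) * μ y), mean_apply, Fintype.expect_eq_sum_div_card, sum_div]
  refine sum_congr rfl fun y _ => ?_
  have hcard : (Fintype.card (Fin k → Ω) : ℝ) ≠ 0 := Nat.cast_ne_zero.2 Fintype.card_ne_zero
  split_ifs
  · rw [one_mul, mul_div_cancel_left₀ _ hcard]
  · rw [zero_mul, zero_div]

lemma pseudoExp_poly_of_isIsolated (h : IsPlausible t I.scopes (I.densities μ) η b D)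
    (hkD : k ≤ D) (htk : t + 1 ≤ 2 * k) (P : (Fin k → Ω) → Bool) {f : Fin m}
    (hf : IsIsolated t I.scopes b f) :
    pseudoExp t I.scopes (I.densities μ) b (Constraint.poly P (I f)) =
      ∑ y, if P y = true then μ y else 0 := by
  have hcard : #(I.scopes f) = k := Constraint.card_scope (I f)
  have hkb : k ≤ b := by have := h.four_mul_le; omega
  rw [pseudoExp_poly h hkD, h.wise.mean_mul_localDensity (subset_tightClosure _)
    (fun M hfM hM => hf.exists_eliminable h.expanding h.pos (by omega) hfM
      ((card_le_card hM).trans (card_tightClosure_le (hcard.trans_le hkb))))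
    (evalFun_mem_juntas (poly_mem_polysOn P (I f))), hf.localDensity_scope h.wise hkb htk]
  exact mean_evalFun_poly_mul_density P (I f)

end Planted

section Value

variable {n m k t : ℕ} {Ω : Type*} [Fintype Ω] [DecidableEq Ω] {L : Finset (Equiv.Perm Ω)}
  {η : ℝ} {b D : ℕ} {I : CSPInstance n m k L} {P : (Fin k → Ω) → Bool}

lemma CSPInstance.map_valuePoly (E : MvPolynomial (Fin n × Ω) ℝ →ₗ[ℝ] ℝ)
    (I : CSPInstance n m k L) (P : (Fin k → Ω) → Bool) :
    E (I.valuePoly P) = (∑ f, E (Constraint.poly P (I f))) / m := by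
  rw [CSPInstance.valuePoly, ← MvPolynomial.smul_eq_C_mul, map_smul, map_sum, smul_eq_mul,
    inv_mul_eq_div]

lemma le_pseudoExp_valuePoly [Nonempty Ω] {μ σ : (Fin k → Ω) → ℝ}
    (h : IsPlausible t I.scopes (I.densities μ) η b D) (hkD : k ≤ D) (htk : t + 1 ≤ 2 * k)
    (hμ : μ ∈ stdSimplex ℝ (Fin k → Ω)) (hσ : σ ∈ stdSimplex ℝ (Fin k → Ω))
    (hP : ∀ x, P x = false → σ x = 0) {G : Finset (Fin m)}
    (hG : ∀ f ∈ G, IsIsolated t I.scopes b f) :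
    #G * (1 - tvDist μ σ) / m ≤ pseudoExp t I.scopes (I.densities μ) b (I.valuePoly P) := by
  rw [CSPInstance.map_valuePoly]
  gcongr
  calc #G * (1 - tvDist μ σ)
      = ∑ _ ∈ G, (1 - tvDist μ σ) := by rw [sum_const, nsmul_eq_mul]
    _ ≤ ∑ f ∈ G, pseudoExp t I.scopes (I.densities μ) b (Constraint.poly P (I f)) :=
        sum_le_sum fun f hf => (one_sub_tvDist_le hμ hσ hP).trans_eq
          (pseudoExp_poly_of_isIsolated h hkD htk P (hG f hf)).symm
    _ ≤ ∑ f, pseudoExp t I.scopes (I.densities μ) b (Constraint.poly P (I f)) :=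
        sum_le_univ_sum_of_nonneg (pseudoExp_poly_nonneg h hkD P)

lemma isWiseUniform_const [Nonempty Ω] (htk : t ≤ k) :
    IsWiseUniform t fun _ : Fin k → Ω => (Fintype.card (Fin k → Ω) : ℝ)⁻¹ := by
  intro T hT a
  have hq : (Fintype.card Ω : ℝ) ≠ 0 := Nat.cast_ne_zero.2 Fintype.card_ne_zero
  obtain ⟨a, rfl⟩ : ∃ a' : Fin k → Ω, (fun i : T => a' i) = a :=
    ⟨fun i => if h : i ∈ T then a ⟨i, h⟩ else Classical.arbitrary Ω, by simp⟩
  rw [sum_const, card_filter_forall_mem_eq, hT, nsmul_eq_mul, Fintype.card_fun, Fintype.card_fin,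
    Nat.cast_pow, Nat.cast_pow, pow_sub₀ _ hq htk, mul_right_comm,
    mul_inv_cancel₀ (pow_ne_zero k hq), one_mul]

lemma exists_tvDist_lt [Nonempty Ω] (htk : t ≤ k) (hP : ∃ x, P x = true) {r : ℝ}
    (hr : deltaP P t < r) : ∃ μ ∈ stdSimplex ℝ (Fin k → Ω), ∃ σ ∈ stdSimplex ℝ (Fin k → Ω),
      IsWiseUniform t μ ∧ (∀ x, P x = false → σ x = 0) ∧ tvDist μ σ < r := by
  obtain ⟨y, hy⟩ := hP
  have huniform : (fun _ => (Fintype.card (Fin k → Ω) : ℝ)⁻¹) ∈ stdSimplex ℝ (Fin k → Ω) :=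
    ⟨fun _ => by positivity, by
      rw [sum_const, nsmul_eq_mul, card_univ,
        mul_inv_cancel₀ (Nat.cast_ne_zero.2 Fintype.card_ne_zero)]⟩
  have hsingle : ∀ x, P x = false → (Pi.single y 1 : (Fin k → Ω) → ℝ) x = 0 := fun x hx =>
    Pi.single_eq_of_ne (by rintro rfl; simp [hy] at hx) 1
  obtain ⟨_, ⟨μ, hμ, σ, hσ, hunif, hsupp, rfl⟩, hlt⟩ := exists_lt_of_csInf_lt
    (by exact ⟨_, _, huniform, _, single_mem_stdSimplex ℝ y, isWiseUniform_const htk, hsingle, rfl⟩)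
    hr
  exact ⟨μ, hμ, σ, hσ, hunif, hsupp, hlt⟩

theorem not_sosRefutes_of_isExpanding [Nonempty Ω] (ht : 1 ≤ t) (htk : t ≤ k)
    (hP : ∃ x, P x = true) (hm : 0 < m) (hexp : IsExpanding t I.scopes η b) (hη : 0 < η)
    (hη1 : η ≤ 1) (hD : 4 * (D : ℝ) ≤ η * b) (hkD : k ≤ D) {ε : ℝ} {G : Finset (Fin m)}
    (hG : ∀ f ∈ G, IsIsolated t I.scopes b f) (hGε : (m : ℝ) - #G < ε * m) :
    ¬ SOSRefutes D P (deltaP P t + ε) I := by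
  intro hrefutes
  have hm' : (0 : ℝ) < m := Nat.cast_pos.2 hm
  have hfrac : 1 - #G / (m : ℝ) < ε := by
    rwa [one_sub_div hm'.ne', div_lt_iff₀ hm']
  obtain ⟨μ, hμ, σ, hσ, hunif, hsupp, htv⟩ :=
    exists_tvDist_lt (r := deltaP P t + (ε - (1 - #G / m))) htk hP (by linarith)
  have h : IsPlausible t I.scopes (I.densities μ) η b D :=
    ⟨hunif.isWiseDensity htk hμ.1 I, hexp, hη, hη1, hD⟩
  have hvalue := (le_pseudoExp_valuePoly h hkD (by omega) hμ hσ hsupp hG).trans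
    (hrefutes _ h.isAssignmentPseudoexpectation)
  have hG1 : #G / (m : ℝ) ≤ 1 :=
    div_le_one_of_le₀ (Nat.cast_le.2 (card_finset_fin_le G)) hm'.le
  rw [mul_div_right_comm, mul_sub, mul_one] at hvalue
  linarith [mul_le_of_le_one_left (tvDist_nonneg μ σ) hG1]

end Value

section SmallDegree

variable {n m k : ℕ} {Ω : Type*} [Fintype Ω] [DecidableEq Ω] {L : Finset (Equiv.Perm Ω)} {D : ℕ}
  {P : (Fin k → Ω) → Bool}

lemma isAssignmentPseudoexpectation_of_eq_eval {E : MvPolynomial (Fin n × Ω) ℝ →ₗ[ℝ] ℝ}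
    (x : Fin n → Ω) (hE : ∀ p, p.totalDegree ≤ D → E p = evalFun p x) :
    IsAssignmentPseudoexpectation D E where
  map_one := by rw [hE 1 (by simp), map_one, Pi.one_apply]
  sq_nonneg p hp := by
    rw [hE _ ((MvPolynomial.totalDegree_pow p 2).trans hp), map_pow]
    exact sq_nonneg _
  sum_eq_one i r hr := by
    rw [hE _ hr, map_mul, Pi.mul_apply]
    simp [evalFun_X]
  sq_eq_self i c r hr := by
    rw [hE _ hr, map_mul, Pi.mul_apply]
    simp [evalFun_X]

/-- The sum of the coefficients of a polynomial in degree `d`. -/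
def coeffSum {V : Type*} (d : ℕ) : MvPolynomial V ℝ →ₗ[ℝ] ℝ :=
  (MvPolynomial.aeval fun _ => (1 : ℝ)).toLinearMap ∘ₗ MvPolynomial.homogeneousComponent d

lemma coeffSum_of_totalDegree_lt {V : Type*} {d : ℕ} {p : MvPolynomial V ℝ}
    (hp : p.totalDegree < d) : coeffSum d p = 0 := by
  rw [coeffSum, LinearMap.comp_apply, MvPolynomial.homogeneousComponent_eq_zero _ _ hp, map_zero]

lemma isHomogeneous_poly (P : (Fin k → Ω) → Bool) (c : Constraint n k L) :
    (Constraint.poly P c).IsHomogeneous k := by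
  refine MvPolynomial.IsHomogeneous.sum _ _ _ fun a _ => ?_
  simpa using MvPolynomial.IsHomogeneous.prod univ
    (fun j => (MvPolynomial.X (c.1 j, a j) : MvPolynomial (Fin n × Ω) ℝ)) (fun _ => 1)
    fun j _ => MvPolynomial.isHomogeneous_X _ _

lemma coeffSum_poly_pos (hP : ∃ x, P x = true) (c : Constraint n k L) :
    0 < coeffSum k (Constraint.poly P c) := by
  obtain ⟨y, hy⟩ := hP
  rw [coeffSum, LinearMap.comp_apply, MvPolynomial.homogeneousComponent_of_mem
    ((MvPolynomial.mem_homogeneousSubmodule _ _).2 (isHomogeneous_poly P c)), if_pos rfl,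
    Constraint.poly]
  simp only [AlgHom.toLinearMap_apply, map_sum, map_prod, MvPolynomial.aeval_X, prod_const_one,
    sum_const, nsmul_eq_mul, mul_one, Nat.cast_pos]
  exact card_pos.2 ⟨fun j => (c.2 j : Equiv.Perm Ω).symm (y j), by simp [hy]⟩

-- A pseudoexpectation is not constrained on polynomials of degree larger than `D`, such as the
-- value when `D < k`: any multiple of its coefficient sum in degree `k` can be added.
theorem not_sosRefutes_of_lt [Nonempty Ω] {I : CSPInstance n m k L} (hP : ∃ x, P x = true)
    (hm : 0 < m) (hDk : D < k) (δ : ℝ) : ¬ SOSRefutes D P δ I := by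
  intro hrefutes
  let x : Fin n → Ω := Classical.arbitrary _
  let E₀ : MvPolynomial (Fin n × Ω) ℝ →ₗ[ℝ] ℝ := LinearMap.proj x ∘ₗ evalFun.toLinearMap
  have hpos : 0 < coeffSum k (I.valuePoly P) := by
    rw [CSPInstance.map_valuePoly]
    exact div_pos (sum_pos (fun f _ => coeffSum_poly_pos hP _) ⟨⟨0, hm⟩, mem_univ _⟩)
      (Nat.cast_pos.2 hm)
  let r : ℝ := (2 - δ - E₀ (I.valuePoly P)) / coeffSum k (I.valuePoly P)
  have heval : ∀ p : MvPolynomial (Fin n × Ω) ℝ, p.totalDegree ≤ D →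
      (E₀ + r • coeffSum k : MvPolynomial (Fin n × Ω) ℝ →ₗ[ℝ] ℝ) p = evalFun p x := by
    intro p hp
    rw [LinearMap.add_apply, LinearMap.smul_apply, coeffSum_of_totalDegree_lt (hp.trans_lt hDk),
      smul_zero, add_zero]
    rfl
  have hvalue := hrefutes _ (isAssignmentPseudoexpectation_of_eq_eval x heval)
  rw [LinearMap.add_apply, LinearMap.smul_apply, smul_eq_mul, div_mul_cancel₀ _ hpos.ne'] at hvalue
  linarith

end SmallDegree

/-! ### Exponential moments of the excess -/

section Embedding

variable {n k : ℕ}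

lemma pow_le_two_pow_mul_card_embedding (h : 2 * k ≤ n) :
    n ^ k ≤ 2 ^ k * Fintype.card (Fin k ↪ Fin n) := by
  rw [Fintype.card_embedding_eq, Fintype.card_fin, Fintype.card_fin]
  calc n ^ k ≤ (2 * (n + 1 - k)) ^ k := Nat.pow_le_pow_left (by omega) k
    _ = 2 ^ k * (n + 1 - k) ^ k := Nat.mul_pow _ _ _
    _ ≤ 2 ^ k * n.descFactorial k := Nat.mul_le_mul_left _ (Nat.pow_sub_le_descFactorial n k)

lemma sum_embedding_prod_le {w : Fin n → ℝ} (hw : ∀ i, 0 ≤ w i) :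
    ∑ e : Fin k ↪ Fin n, ∏ j, w (e j) ≤ (∑ i, w i) ^ k := by
  rw [Fintype.sum_pow]
  exact (sum_map univ ⟨_, DFunLike.coe_injective⟩ fun p : Fin k → Fin n => ∏ j, w (p j)).ge.trans
    (sum_le_univ_sum_of_nonneg fun p => prod_nonneg fun j _ => hw (p j))

end Embedding

section RandomConstraint

variable {n k t : ℕ} {Ω : Type*} {L : Finset (Equiv.Perm Ω)} {u ζ : ℝ} {M : Finset (Fin n)}

lemma expect_prod_scope_le (h : 2 * k ≤ n) {w : Fin n → ℝ} (hw : ∀ i, 0 ≤ w i) :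
    𝔼 c : Constraint n k L, ∏ i ∈ Constraint.scope c, w i ≤ (2 * (∑ i, w i) / n) ^ k := by
  have hsum : 0 ≤ ∑ i, w i := sum_nonneg fun i _ => hw i
  have hcard : (1 : ℝ) ≤ (2 / n) ^ k * Fintype.card (Fin k ↪ Fin n) := by
    rcases n.eq_zero_or_pos with rfl | hn
    · obtain rfl : k = 0 := by omega
      simp
    · rw [div_pow, div_mul_eq_mul_div, one_le_div (by positivity)]
      exact_mod_cast pow_le_two_pow_mul_card_embedding h
  rw [Fintype.expect_eq_sum_div_card]
  refine div_le_of_le_mul₀ (Nat.cast_nonneg _) (by positivity) ?_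
  calc ∑ c : Constraint n k L, ∏ i ∈ Constraint.scope c, w i
      = Fintype.card (Fin k → L) * ∑ e : Fin k ↪ Fin n, ∏ j, w (e j) := by
        simp only [Constraint.scope, prod_map, Fintype.sum_prod_type, sum_const, nsmul_eq_mul,
          mul_sum, card_univ]
    _ ≤ Fintype.card (Fin k → L) *
          ((2 / n) ^ k * Fintype.card (Fin k ↪ Fin n) * (∑ i, w i) ^ k) := by
        gcongr
        exact (sum_embedding_prod_le hw).trans (le_mul_of_one_le_left (by positivity) hcard)
    _ = (2 * (∑ i, w i) / n) ^ k * Fintype.card (Constraint n k L) := by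
        rw [Fintype.card_prod, Nat.cast_mul, mul_div_right_comm, mul_pow]
        ring

lemma expect_scope_subset_le (h : 2 * k ≤ n) (M : Finset (Fin n)) :
    𝔼 c : Constraint n k L, (if Constraint.scope c ⊆ M then (1 : ℝ) else 0)
      ≤ (2 * #M / n) ^ k := by
  have hprod := expect_prod_scope_le (L := L) h (w := fun i => if i ∈ M then (1 : ℝ) else 0)
    fun i => by positivity
  rw [sum_boole, filter_univ_mem] at hprod
  refine (expect_congr rfl fun c _ => ?_).trans_le hprod
  rw [prod_ite_zero, prod_const_one]
  congr

/-- The exponent by which an excess `e` contributes to the exponential moments: a constant `u` is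
gained from each constraint with positive excess, on top of `ζ` times the excess. -/
def tilt (u ζ : ℝ) (e : ℤ) : ℝ :=
  if 0 < e then u + ζ * e else 0

lemma exp_tilt_excess_le (c : Constraint n k L) :
    Real.exp (tilt u ζ (excess t Constraint.scope M c)) ≤ 1 + Real.exp (u - ζ * (t + 1)) *
      ∏ i ∈ Constraint.scope c, if i ∈ M then 1 + Real.exp (2 * ζ) else 1 := by
  rw [prod_ite_mem, prod_const]
  unfold tilt
  split_ifs with hpos
  · have hexcess : excess t Constraint.scope M c = 2 * #(Constraint.scope c ∩ M) - (t + 1) := by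
      unfold excess at hpos ⊢
      omega
    calc Real.exp (u + ζ * (excess t Constraint.scope M c))
        = Real.exp (u - ζ * (t + 1)) * Real.exp (2 * ζ) ^ #(Constraint.scope c ∩ M) := by
          rw [← Real.exp_nat_mul, ← Real.exp_add, hexcess]
          push_cast
          ring_nf
      _ ≤ Real.exp (u - ζ * (t + 1)) * (1 + Real.exp (2 * ζ)) ^ #(Constraint.scope c ∩ M) := by
          gcongr
          exact le_add_of_nonneg_left zero_le_one
      _ ≤ _ := le_add_of_nonneg_left zero_le_one
  · rw [Real.exp_zero]
    exact le_add_of_nonneg_right (by positivity)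

lemma two_mul_one_add_exp_five_le : 2 * (1 + Real.exp 5) ≤ Real.exp 6 := by
  have hsplit : Real.exp 6 = Real.exp 5 * Real.exp 1 := by rw [← Real.exp_add]; norm_num
  rw [hsplit]
  nlinarith [Real.add_one_le_exp (5 : ℝ), Real.exp_one_gt_d9]

lemma expect_exp_tilt_le (h : 2 * k ≤ n) (hn : 0 < n)
    (hζ : Real.exp (2 * ζ) * #M = Real.exp 5 * n) :
    𝔼 c : Constraint n k L, Real.exp (tilt u ζ (excess t Constraint.scope M c))
      ≤ 1 + Real.exp (u - ζ * (t + 1) + 6 * k) := by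
  have hn' : (n : ℝ) ≠ 0 := by positivity
  have hsum : ∑ i, (if i ∈ M then 1 + Real.exp (2 * ζ) else 1) = n * (1 + Real.exp 5) := by
    have hsplit (i) : (if i ∈ M then 1 + Real.exp (2 * ζ) else 1) =
        1 + if i ∈ M then Real.exp (2 * ζ) else 0 := by split_ifs <;> simp
    simp only [hsplit, sum_add_distrib, sum_ite_mem, univ_inter, sum_const, card_univ,
      Fintype.card_fin, nsmul_eq_mul]
    linarith
  have hprod : 𝔼 c : Constraint n k L,
      ∏ i ∈ Constraint.scope c, (if i ∈ M then 1 + Real.exp (2 * ζ) else 1)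
        ≤ Real.exp (6 * k) := by
    refine (expect_prod_scope_le h fun i => by positivity).trans ?_
    rw [hsum, mul_left_comm, mul_div_cancel_left₀ _ hn', mul_comm (6 : ℝ), Real.exp_nat_mul]
    exact pow_le_pow_left₀ (by positivity) two_mul_one_add_exp_five_le k
  have hone : 𝔼 _c : Constraint n k L, (1 : ℝ) ≤ 1 := by
    rw [Fintype.expect_eq_sum_div_card, sum_const, card_univ, nsmul_one]
    exact div_self_le_one _
  calc 𝔼 c : Constraint n k L, Real.exp (tilt u ζ (excess t Constraint.scope M c))
      ≤ 𝔼 c : Constraint n k L, (1 + Real.exp (u - ζ * (t + 1)) *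
          ∏ i ∈ Constraint.scope c, if i ∈ M then 1 + Real.exp (2 * ζ) else 1) :=
        expect_le_expect fun c _ => exp_tilt_excess_le c
    _ ≤ 1 + Real.exp (u - ζ * (t + 1)) * Real.exp (6 * k) := by
        rw [expect_add_distrib, ← mul_expect]
        gcongr
    _ = _ := by rw [← Real.exp_add]

end RandomConstraint

section RandomInstance

variable {n m k t : ℕ} {Ω : Type*} {L : Finset (Equiv.Perm Ω)}

instance : Fintype (CSPInstance n m k L) :=
  inferInstanceAs (Fintype (Fin m → Constraint n k L))

lemma CSPInstance.expect_prod (W : Fin m → Constraint n k L → ℝ) :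
    𝔼 I : CSPInstance n m k L, ∏ f, W f (I f) = ∏ f, 𝔼 c, W f c := by
  have hcard : Fintype.card (CSPInstance n m k L) = Fintype.card (Constraint n k L) ^ m :=
    (Fintype.card_fun (α := Fin m)).trans (by rw [Fintype.card_fin])
  simp only [Fintype.expect_eq_sum_div_card, prod_div_distrib, prod_const, card_univ,
    Fintype.card_fin, hcard, Nat.cast_pow, Fintype.prod_sum]
  rfl

lemma CSPInstance.expect_mul_prod_erase (f₀ : Fin m) (g h : Constraint n k L → ℝ) :
    𝔼 I : CSPInstance n m k L, g (I f₀) * ∏ f ∈ univ.erase f₀, h (I f) =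
      (𝔼 c, g c) * (𝔼 c, h c) ^ (m - 1) := by
  have hprod := CSPInstance.expect_prod (Function.update (fun _ => h) f₀ g)
  have herase (a : (Constraint n k L → ℝ) → Fin m → ℝ) :
      ∏ f, a (Function.update (fun _ => h) f₀ g f) f =
        a g f₀ * ∏ f ∈ univ.erase f₀, a h f := by
    rw [← mul_prod_erase _ _ (mem_univ f₀), Function.update_self]
    congr 1
    exact prod_congr rfl fun f hf => by rw [Function.update_of_ne (ne_of_mem_erase hf)]
  simp only [herase fun φ _ => 𝔼 c, φ c, prod_const, card_erase_of_mem (mem_univ f₀), card_univ,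
    Fintype.card_fin] at hprod
  rw [← hprod]
  exact expect_congr rfl fun I _ => (herase fun φ f => φ (I f)).symm

variable {Δ : ℝ} {M : Finset (Fin n)}

/-- Half the logarithm of `e⁵ n / v`: the tilting rate for sets of `v` variables. -/
def logRatio (n v : ℕ) : ℝ :=
  (5 + Real.log n - Real.log v) / 2

/-- The logarithm of the factor gained from each constraint with positive excess on a set of `v`
variables, chosen so that the exponential moments over random instances are at most `e ^ v`. -/
def logGain (k t n : ℕ) (Δ : ℝ) (v : ℕ) : ℝ :=
  (t - 1) * logRatio n v - Real.log Δ - 6 * k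

lemma exp_two_mul_logRatio {v : ℕ} (hn : 0 < n) (hv : 0 < v) :
    Real.exp (2 * logRatio n v) * v = Real.exp 5 * n := by
  have hn' : (0 : ℝ) < n := Nat.cast_pos.2 hn
  have hv' : (0 : ℝ) < v := Nat.cast_pos.2 hv
  rw [logRatio, mul_div_cancel₀ _ two_ne_zero, Real.exp_sub, Real.exp_add, Real.exp_log hn',
    Real.exp_log hv', div_mul_cancel₀ _ hv'.ne']

lemma logRatio_nonneg {v : ℕ} (hv : 0 < v) (hvn : v ≤ n) : 0 ≤ logRatio n v := by
  have := Real.log_le_log (Nat.cast_pos.2 hv) (Nat.cast_le (α := ℝ).2 hvn)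
  unfold logRatio
  linarith

lemma one_add_exp_logGain_pow_le (hn : 0 < n) (hΔ : 0 < Δ) (hm : (m : ℝ) = Δ * n) {v : ℕ}
    (hv : 0 < v) :
    (1 + Real.exp (logGain k t n Δ v - logRatio n v * (t + 1) + 6 * k)) ^ m ≤ Real.exp v := by
  have hexponent : logGain k t n Δ v - logRatio n v * (t + 1) + 6 * k
      = -(2 * logRatio n v) - Real.log Δ := by
    unfold logGain
    ring
  set p := Real.exp (-(2 * logRatio n v) - Real.log Δ) with hp
  have hmp : m * p ≤ v := by
    have hcancel : m * p = n / Real.exp (2 * logRatio n v) := by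
      rw [hp, Real.exp_sub, Real.exp_neg, Real.exp_log hΔ, hm]
      field_simp
    rw [hcancel, div_le_iff₀ (Real.exp_pos _), mul_comm, exp_two_mul_logRatio hn hv]
    exact le_mul_of_one_le_left (Nat.cast_nonneg n) (Real.one_le_exp (by norm_num))
  rw [hexponent]
  calc (1 + p) ^ m ≤ Real.exp p ^ m := by
        gcongr
        linarith [Real.add_one_le_exp p]
    _ = Real.exp (m * p) := (Real.exp_nat_mul p m).symm
    _ ≤ Real.exp v := Real.exp_le_exp.2 hmp

lemma expect_exp_sum_tilt_le (h : 2 * k ≤ n) (hΔ : 0 < Δ) (hm : (m : ℝ) = Δ * n)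
    (hM : M.Nonempty) :
    𝔼 I : CSPInstance n m k L,
        Real.exp (∑ f, tilt (logGain k t n Δ #M) (logRatio n #M) (excess t I.scopes M f))
      ≤ Real.exp #M := by
  have hn : 0 < n := hM.choose.pos
  simp only [Real.exp_sum]
  refine (CSPInstance.expect_prod fun _ c => Real.exp (tilt (logGain k t n Δ #M) (logRatio n #M)
    (excess t Constraint.scope M c))).trans_le ?_
  rw [prod_const, card_univ, Fintype.card_fin]
  refine (pow_le_pow_left₀ (expect_nonneg fun _ _ => (Real.exp_pos _).le)
    (expect_exp_tilt_le h hn (exp_two_mul_logRatio hn hM.card_pos)) m).trans ?_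
  exact one_add_exp_logGain_pow_le hn hΔ hm hM.card_pos

lemma expect_scope_subset_mul_exp_sum_tilt_le (h : 2 * k ≤ n) (hΔ : 0 < Δ)
    (hm : (m : ℝ) = Δ * n) (hM : M.Nonempty) (f₀ : Fin m) :
    𝔼 I : CSPInstance n m k L, (if I.scopes f₀ ⊆ M then 1 else 0) *
        Real.exp (∑ f ∈ univ.erase f₀,
          tilt (logGain k t n Δ #M) (logRatio n #M) (excess t I.scopes M f))
      ≤ (2 * #M / n) ^ k * Real.exp #M := by
  have hn : 0 < n := hM.choose.pos
  simp only [Real.exp_sum]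
  refine (CSPInstance.expect_mul_prod_erase f₀
    (fun c => if Constraint.scope c ⊆ M then 1 else 0)
    fun c => Real.exp (tilt (logGain k t n Δ #M) (logRatio n #M)
      (excess t Constraint.scope M c))).trans_le ?_
  have hmoment := expect_exp_tilt_le (L := L) (t := t) (u := logGain k t n Δ #M) h hn
    (exp_two_mul_logRatio hn hM.card_pos)
  refine mul_le_mul (expect_scope_subset_le h M) ?_
    (pow_nonneg (expect_nonneg fun _ _ => (Real.exp_pos _).le) _) (by positivity)
  calc _ ≤ _ := pow_le_pow_left₀ (expect_nonneg fun _ _ => (Real.exp_pos _).le) hmoment (m - 1)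
    _ ≤ _ := pow_le_pow_right₀ (le_add_of_nonneg_right (Real.exp_pos _).le) (Nat.sub_le m 1)
    _ ≤ Real.exp #M := one_add_exp_logGain_pow_le hn hΔ hm hM.card_pos

end RandomInstance

section Tilt

variable {F : Type*} {s : Finset F} {e : F → ℤ} {u ζ : ℝ}

lemma sum_tilt_eq (he : ∀ f ∈ s, 0 ≤ e f) :
    ∑ f ∈ s, tilt u ζ (e f) = u * #{f ∈ s | 0 < e f} + ζ * (∑ f ∈ s, e f : ℤ) := by
  rw [card_filter]
  push_cast
  rw [mul_sum, mul_sum, ← sum_add_distrib]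
  refine sum_congr rfl fun f hf => ?_
  rcases (he f hf).eq_or_lt with hzero | hpos
  · simp [tilt, ← hzero]
  · simp [tilt, hpos]

lemma sum_le_mul_card_filter_pos {B : ℤ} (hB : ∀ f ∈ s, e f ≤ B) :
    ∑ f ∈ s, e f ≤ B * #{f ∈ s | 0 < e f} := by
  calc ∑ f ∈ s, e f ≤ ∑ f ∈ s, if 0 < e f then B else 0 := sum_le_sum fun f hf => by
        split_ifs with hpos
        exacts [hB f hf, not_lt.1 hpos]
    _ = _ := by rw [← sum_filter, sum_const, nsmul_eq_mul, mul_comm]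

lemma add_mul_le_sum_tilt (he : ∀ f ∈ s, 0 ≤ e f) (hu : 0 ≤ u) (hζ : 0 ≤ ζ) {Y : ℝ} (hY : 0 < Y)
    (hYe : Y ≤ (∑ f ∈ s, e f : ℤ)) : u + ζ * Y ≤ ∑ f ∈ s, tilt u ζ (e f) := by
  have hpos : 0 < ∑ f ∈ s, e f := by exact_mod_cast hY.trans_le hYe
  obtain ⟨f, hf, hef⟩ := exists_lt_of_sum_lt (by simpa using hpos : ∑ f ∈ s, 0 < ∑ f ∈ s, e f)
  have hone : (1 : ℝ) ≤ #{f ∈ s | 0 < e f} :=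
    Nat.one_le_cast.2 (card_pos.2 ⟨f, mem_filter.2 ⟨hf, hef⟩⟩)
  rw [sum_tilt_eq he]
  exact add_le_add (le_mul_of_one_le_right hu hone) (mul_le_mul_of_nonneg_left hYe hζ)

variable {V : Type*} [DecidableEq V] {k t : ℕ} {N : F → Finset V} {M : Finset V}

lemma excess_le (f : F) : excess t N M f ≤ 2 * #(N f) := by
  have := card_le_card (inter_subset_left : N f ∩ M ⊆ N f)
  unfold excess
  omega

variable [Fintype F]

lemma le_sum_tilt_of_weight_lt {η : ℝ} (hk : 0 < k) (hN : ∀ f, #(N f) ≤ k) (hu : 0 ≤ u)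
    (hζ : 0 ≤ ζ) (hη : η ≤ 1) (hM : M.Nonempty) (hw : weight t N M < η * #M) :
    u / 2 + u * #M / (4 * k) + ζ * ((2 - η) * #M) ≤ ∑ f, tilt u ζ (excess t N M f) := by
  have hk' : (0 : ℝ) < k := Nat.cast_pos.2 hk
  have hM' : (0 : ℝ) < #M := Nat.cast_pos.2 hM.card_pos
  have hsum : (2 - η) * #M ≤ (∑ f, excess t N M f : ℤ) := by
    rw [weight] at hw
    push_cast at hw ⊢
    linarith
  have hcard : (#M : ℝ) ≤ #{f | 0 < excess t N M f} * (2 * k) := by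
    have hle : ∑ f, excess t N M f ≤ 2 * k * #{f | 0 < excess t N M f} :=
      sum_le_mul_card_filter_pos fun f _ => (excess_le f).trans (by have := hN f; omega)
    have hle' : ((∑ f, excess t N M f : ℤ) : ℝ) ≤ 2 * k * #{f | 0 < excess t N M f} := by
      exact_mod_cast hle
    nlinarith
  have htilt := add_mul_le_sum_tilt (fun f _ => excess_nonneg f) hu hζ
    (by nlinarith : 0 < (2 - η) * #M) hsum
  have hmany : u * #M / (2 * k) + ζ * ((2 - η) * #M) ≤ ∑ f, tilt u ζ (excess t N M f) := by
    rw [sum_tilt_eq fun f _ => excess_nonneg f, mul_div_assoc]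
    gcongr
    rwa [div_le_iff₀ (by positivity)]
  have hhalf : u * #M / (4 * k) = u * #M / (2 * k) / 2 := by
    rw [div_div]
    ring_nf
  linarith

lemma le_sum_tilt_of_weight_le [DecidableEq F] {f₀ : F} (htk : t + 1 ≤ 2 * #(N f₀)) (hu : 0 ≤ u)
    (hζ : 0 ≤ ζ) (hf₀ : N f₀ ⊆ M) (hw : weight t N M ≤ t) :
    u + ζ * (2 * (#M - #(N f₀)) + 1) ≤ ∑ f ∈ univ.erase f₀, tilt u ζ (excess t N M f) := by
  have hcard : (#(N f₀) : ℝ) ≤ #M := Nat.cast_le.2 (card_le_card hf₀)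
  refine add_mul_le_sum_tilt (fun f _ => excess_nonneg f) hu hζ (by linarith) ?_
  rw [weight, ← add_sum_erase _ _ (mem_univ f₀), excess, inter_eq_left.2 hf₀] at hw
  have hsum : 2 * ((#M : ℤ) - #(N f₀)) + 1 ≤ ∑ f ∈ univ.erase f₀, excess t N M f := by omega
  exact_mod_cast hsum

end Tilt

/-! ### Union bounds over small sets of variables -/

section RandomInstance

variable {n m k : ℕ} {Ω : Type*} {L : Finset (Equiv.Perm Ω)}

instance : MeasurableSingletonClass (CSPInstance n m k L) := ⟨fun _ => trivial⟩

instance : IsFiniteMeasure (randomInstance n m k L) :=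
  inferInstanceAs (IsFiniteMeasure (uniformOn Set.univ))

lemma randomInstance_real_mul_le_expect {S : Set (CSPInstance n m k L)}
    {g : CSPInstance n m k L → ℝ} (hg : ∀ I, 0 ≤ g I) {a : ℝ} (ha : ∀ I ∈ S, a ≤ g I) :
    (randomInstance n m k L).real S * a ≤ 𝔼 I, g I := by
  classical
  have hS : (randomInstance n m k L).real S =
      #{I | I ∈ S} / Fintype.card (CSPInstance n m k L) := by
    have hcoe : S = ({I | I ∈ S} : Finset (CSPInstance n m k L)) := by simp
    rw [measureReal_def, randomInstance, uniformOn_univ]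
    conv_lhs => rw [hcoe]
    rw [Measure.count_apply_finset, ENNReal.toReal_div, ENNReal.toReal_natCast,
      ENNReal.toReal_natCast]
  rw [hS, div_mul_eq_mul_div, Fintype.expect_eq_sum_div_card, ← nsmul_eq_mul]
  gcongr
  exact (card_nsmul_le_sum _ _ _ fun I hI => ha I (mem_filter.1 hI).2).trans
    (sum_le_univ_sum_of_nonneg hg)

lemma randomInstance_real_le_exp_sub {S : Set (CSPInstance n m k L)}
    {g : CSPInstance n m k L → ℝ} (hg : ∀ I, 0 ≤ g I) {a c : ℝ} (hS : ∀ I ∈ S, Real.exp a ≤ g I)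
    (hc : 𝔼 I, g I ≤ Real.exp c) : (randomInstance n m k L).real S ≤ Real.exp (c - a) := by
  rw [Real.exp_sub, le_div_iff₀ (Real.exp_pos a)]
  exact (randomInstance_real_mul_le_expect hg hS).trans hc

variable {t : ℕ} {Δ : ℝ} {M : Finset (Fin n)}

lemma randomInstance_real_weight_lt_le {η : ℝ} (hk : 0 < k) (h : 2 * k ≤ n) (hΔ : 0 < Δ)
    (hm : (m : ℝ) = Δ * n) (hη : η ≤ 1) (hM : M.Nonempty) (hu : 0 ≤ logGain k t n Δ #M) :
    (randomInstance n m k L).real {I | (weight t I.scopes M : ℝ) < η * #M} ≤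
      Real.exp (#M - (logGain k t n Δ #M / 2 + logGain k t n Δ #M * #M / (4 * k) +
        logRatio n #M * ((2 - η) * #M))) :=
  randomInstance_real_le_exp_sub (fun _ => (Real.exp_pos _).le)
    (fun I hI => Real.exp_le_exp.2 (le_sum_tilt_of_weight_lt hk
      (fun f => (Constraint.card_scope (I f)).le) hu
      (logRatio_nonneg hM.card_pos (card_finset_fin_le M)) hη hM hI))
    (expect_exp_sum_tilt_le h hΔ hm hM)

lemma two_mul_div_pow_le_exp {v : ℕ} (hn : 0 < n) (hv : 0 < v) :
    (2 * v / n : ℝ) ^ k ≤ Real.exp (k * (6 - 2 * logRatio n v)) := by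
  have hn' : (0 : ℝ) < n := Nat.cast_pos.2 hn
  have hdiv : (v : ℝ) / n = Real.exp (5 - 2 * logRatio n v) := by
    rw [Real.exp_sub, div_eq_div_iff hn'.ne' (Real.exp_pos _).ne', mul_comm,
      exp_two_mul_logRatio hn hv]
  have hsix : 6 - 2 * logRatio n v = 1 + (5 - 2 * logRatio n v) := by ring
  rw [Real.exp_nat_mul, hsix, Real.exp_add, mul_div_assoc, hdiv]
  gcongr
  linarith [Real.exp_one_gt_d9]

lemma randomInstance_real_scope_subset_le (h : 2 * k ≤ n) (htk : t + 1 ≤ 2 * k) (hΔ : 0 < Δ)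
    (hm : (m : ℝ) = Δ * n) (hM : M.Nonempty) (hu : 0 ≤ logGain k t n Δ #M) (f₀ : Fin m) :
    (randomInstance n m k L).real {I | I.scopes f₀ ⊆ M ∧ weight t I.scopes M ≤ t} ≤
      Real.exp (k * (6 - 2 * logRatio n #M) + #M -
        (logGain k t n Δ #M + logRatio n #M * (2 * (#M - k) + 1))) := by
  refine randomInstance_real_le_exp_sub (fun I => ?_) (fun I hI => ?_)
    ((expect_scope_subset_mul_exp_sum_tilt_le (t := t) h hΔ hm hM f₀).trans ?_)
  · positivity
  · have hcard : #(I.scopes f₀) = k := Constraint.card_scope (I f₀)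
    have htilt := le_sum_tilt_of_weight_le (by omega) hu
      (logRatio_nonneg hM.card_pos (card_finset_fin_le M)) hI.1 hI.2
    rw [hcard] at htilt
    rw [if_pos hI.1, one_mul]
    exact Real.exp_le_exp.2 htilt
  · rw [Real.exp_add]
    gcongr
    exact two_mul_div_pow_le_exp hM.choose.pos hM.card_pos

end RandomInstance

section SmallSets

lemma exp_neg_le_half_pow (v : ℕ) : Real.exp (-v) ≤ (1 / 2) ^ v := by
  rw [← mul_neg_one, Real.exp_nat_mul, Real.exp_neg, one_div]
  gcongr
  linarith [Real.exp_one_gt_d9]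

lemma measureReal_exists_small_le {A V : Type*} [MeasurableSpace A] {μ : Measure A}
    [IsFiniteMeasure μ] [Fintype V] {bad : Finset V → Set A} {b : ℕ} {B : ℝ} (hB : 0 ≤ B)
    (h : ∀ M : Finset V, M.Nonempty → #M ≤ b →
      (Fintype.card V).choose #M * μ.real (bad M) ≤ B * Real.exp (-#M)) :
    μ.real {x | ∃ M : Finset V, M.Nonempty ∧ #M ≤ b ∧ x ∈ bad M} ≤ B := by
  classical
  set n := Fintype.card V
  set g : ℕ → ℝ := fun v => if v = 0 then 0 else B * (1 / 2) ^ v / n.choose v with hg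
  have hchoose {v : ℕ} (hv : v ≤ n) : (0 : ℝ) < n.choose v := Nat.cast_pos.2 (Nat.choose_pos hv)
  have hbad (M : Finset V) (hM : M.Nonempty ∧ #M ≤ b) : μ.real (bad M) ≤ g #M := by
    simp only [hg, if_neg hM.1.card_ne_zero]
    rw [le_div_iff₀ (hchoose (card_le_univ M)), mul_comm]
    exact (h M hM.1 hM.2).trans (mul_le_mul_of_nonneg_left (exp_neg_le_half_pow _) hB)
  have hcover : {x | ∃ M : Finset V, M.Nonempty ∧ #M ≤ b ∧ x ∈ bad M} =
      ⋃ M ∈ ({M | M.Nonempty ∧ #M ≤ b} : Finset (Finset V)), bad M := by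
    ext x
    simp [and_assoc]
  calc μ.real {x | ∃ M : Finset V, M.Nonempty ∧ #M ≤ b ∧ x ∈ bad M}
      ≤ ∑ M : Finset V with M.Nonempty ∧ #M ≤ b, μ.real (bad M) := by
        rw [hcover]
        exact measureReal_biUnion_finset_le _ _
    _ ≤ ∑ M : Finset V with M.Nonempty ∧ #M ≤ b, g #M :=
        sum_le_sum fun M hM => hbad M (mem_filter.1 hM).2
    _ ≤ ∑ M : Finset V, g #M := sum_le_univ_sum_of_nonneg fun M => by positivity
    _ = ∑ v ∈ range n, B * (1 / 2) ^ (v + 1) := by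
        rw [← powerset_univ, sum_powerset_apply_card, card_univ, sum_range_succ']
        simp only [hg, if_true, smul_zero, add_zero, Nat.succ_ne_zero, if_false, nsmul_eq_mul]
        refine sum_congr rfl fun v hv => ?_
        exact mul_div_cancel₀ _ (hchoose (mem_range.1 hv)).ne'
    _ = B / 2 * ∑ v ∈ range n, (1 / 2) ^ v := by
        rw [mul_sum]
        exact sum_congr rfl fun v _ => by ring
    _ ≤ B := by nlinarith [sum_geometric_two_le n]

end SmallSets

section UnionBound

variable {n m k t b : ℕ} {Ω : Type*} {L : Finset (Equiv.Perm Ω)} {Δ β : ℝ}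

lemma choose_le_exp {v : ℕ} (hn : 0 < n) (hv : 0 < v) :
    (n.choose v : ℝ) ≤ Real.exp (v * (2 * logRatio n v - 4)) := by
  have hn' : (n : ℝ) = v * Real.exp (2 * logRatio n v - 5) := by
    rw [Real.exp_sub, mul_div_assoc', mul_comm, exp_two_mul_logRatio hn hv,
      mul_div_cancel_left₀ _ (Real.exp_pos 5).ne']
  calc (n.choose v : ℝ) ≤ (n : ℝ) ^ v / v.factorial := Nat.choose_le_pow_div v n
    _ = (v : ℝ) ^ v / v.factorial * Real.exp (v * (2 * logRatio n v - 5)) := by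
        conv_lhs => rw [hn', mul_pow, ← Real.exp_nat_mul, mul_div_right_comm]
    _ ≤ Real.exp v * Real.exp (v * (2 * logRatio n v - 5)) := by
        gcongr
        exact Real.pow_div_factorial_le_exp _ (Nat.cast_nonneg v) v
    _ = Real.exp (v * (2 * logRatio n v - 4)) := by
        rw [← Real.exp_add]
        ring_nf

lemma one_le_log (hΔ : 10 ≤ Δ) : 1 ≤ Real.log Δ := by
  rw [Real.le_log_iff_exp_le (by linarith)]
  linarith [Real.exp_one_lt_d9]

/-- The rate of expansion which random instances with `Δ n` constraints have with high
probability. -/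
def expansionRate (k : ℕ) (Δ : ℝ) : ℝ :=
  1 / (10 * k * Real.log Δ)

lemma ten_le_inv_expansionRate (hk : 0 < k) (hΔ : 10 ≤ Δ) : 10 ≤ 10 * k * Real.log Δ := by
  have hk' : (1 : ℝ) ≤ k := Nat.one_le_cast.2 hk
  nlinarith [one_le_log hΔ]

lemma expansionRate_pos (hk : 0 < k) (hΔ : 10 ≤ Δ) : 0 < expansionRate k Δ :=
  one_div_pos.2 (by linarith [ten_le_inv_expansionRate hk hΔ])

lemma expansionRate_le_one (hk : 0 < k) (hΔ : 10 ≤ Δ) : expansionRate k Δ ≤ 1 :=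
  div_le_one_of_le₀ (by linarith [ten_le_inv_expansionRate hk hΔ])
    (by linarith [ten_le_inv_expansionRate hk hΔ])

lemma expansionRate_mul_logRatio_le {v : ℕ} (hk : 0 < k) (ht : 1 < t) (hΔ : 10 ≤ Δ)
    (hu : 0 ≤ logGain k t n Δ v) (hζ : 0 ≤ logRatio n v) :
    expansionRate k Δ * logRatio n v ≤ 2 + logGain k t n Δ v / (4 * k) := by
  have hk' : (1 : ℝ) ≤ k := Nat.one_le_cast.2 hk
  have ht' : (2 : ℝ) ≤ t := by exact_mod_cast ht
  have hlog := one_le_log hΔ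
  have hζu : logRatio n v ≤ logGain k t n Δ v + Real.log Δ + 6 * k := by
    unfold logGain
    nlinarith
  rw [expansionRate, one_div, inv_mul_eq_div, div_le_iff₀ (by positivity)]
  calc logRatio n v ≤ logGain k t n Δ v + Real.log Δ + 6 * k := hζu
    _ ≤ 20 * k * Real.log Δ + logGain k t n Δ v * (10 / 4) * Real.log Δ := by nlinarith
    _ = (2 + logGain k t n Δ v / (4 * k)) * (10 * k * Real.log Δ) := by
        field_simp
        ring

lemma zero_le_log_two_div (hβ : 0 < β) (hβ1 : β < 1) : 0 ≤ Real.log (2 / β) :=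
  Real.log_nonneg (by rw [le_div_iff₀ hβ]; linarith)

lemma randomInstance_real_not_isExpanding_le (hk : 0 < k) (ht : 1 < t) (h : 2 * k ≤ n)
    (hΔ : 10 ≤ Δ) (hm : (m : ℝ) = Δ * n) (hβ : 0 < β) (hβ1 : β < 1)
    (hgain : ∀ v, 0 < v → v ≤ b → 6 * k + 2 * Real.log (2 / β) ≤ logGain k t n Δ v) :
    (randomInstance n m k L).real {I | ¬ IsExpanding t I.scopes (expansionRate k Δ) b} ≤
      β / 2 := by
  have hlogβ := zero_le_log_two_div hβ hβ1
  have hsub : {I : CSPInstance n m k L | ¬ IsExpanding t I.scopes (expansionRate k Δ) b} ⊆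
      {I | ∃ M : Finset (Fin n), M.Nonempty ∧ #M ≤ b ∧
        I ∈ {I | (weight t I.scopes M : ℝ) < expansionRate k Δ * #M}} := by
    intro I hI
    simp only [Set.mem_ofPred_eq, IsExpanding, not_forall, not_le] at hI
    obtain ⟨M, hMb, hMw⟩ := hI
    refine ⟨M, nonempty_iff_ne_empty.2 ?_, hMb, hMw⟩
    rintro rfl
    simp at hMw
  refine (measureReal_mono hsub).trans (measureReal_exists_small_le (by positivity) ?_)
  intro M hM hMb
  have hv : (1 : ℝ) ≤ #M := Nat.one_le_cast.2 hM.card_pos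
  have hu := hgain _ hM.card_pos hMb
  have hu₀ : 0 ≤ logGain k t n Δ #M := le_trans (by positivity) hu
  have hkey := mul_le_mul_of_nonneg_right (expansionRate_mul_logRatio_le hk ht hΔ hu₀
    (logRatio_nonneg hM.card_pos (card_finset_fin_le M))) (zero_le_one.trans hv)
  rw [Fintype.card_fin]
  calc n.choose #M * (randomInstance n m k L).real _
      ≤ Real.exp (#M * (2 * logRatio n #M - 4)) * Real.exp (#M -
          (logGain k t n Δ #M / 2 + logGain k t n Δ #M * #M / (4 * k) +
            logRatio n #M * ((2 - expansionRate k Δ) * #M))) := by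
        gcongr
        · exact choose_le_exp hM.choose.pos hM.card_pos
        · exact randomInstance_real_weight_lt_le hk h (by linarith) hm
            (expansionRate_le_one hk hΔ) hM hu₀
    _ ≤ Real.exp (-Real.log (2 / β) + -#M) := by
        rw [← Real.exp_add, Real.exp_le_exp]
        rw [add_mul, div_mul_eq_mul_div] at hkey
        linarith
    _ = β / 2 * Real.exp (-#M) := by
        rw [Real.exp_add, Real.exp_neg, Real.exp_log (by positivity), inv_div]

lemma neg_logRatio_le {v : ℕ} (hv : 0 < v) : -logRatio n v ≤ v + -(Real.log n / 2) := by
  unfold logRatio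
  linarith [Real.log_le_sub_one_of_pos (Nat.cast_pos.2 hv : (0 : ℝ) < v)]

lemma randomInstance_real_not_isIsolated_le (hk : 0 < k) (htk : t ≤ k) (h : 2 * k ≤ n)
    (hΔ : 0 < Δ) (hm : (m : ℝ) = Δ * n) (hβ : 0 < β) (hβ1 : β < 1)
    (hgain : ∀ v, 0 < v → v ≤ b → 6 * k + 2 * Real.log (2 / β) ≤ logGain k t n Δ v)
    (f₀ : Fin m) :
    (randomInstance n m k L).real {I | ¬ IsIsolated t I.scopes b f₀} ≤ β / 2 / √n := by
  have hn : 0 < n := by omega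
  have hlogβ := zero_le_log_two_div hβ hβ1
  have hsub : {I : CSPInstance n m k L | ¬ IsIsolated t I.scopes b f₀} ⊆
      {I | ∃ M : Finset (Fin n), M.Nonempty ∧ #M ≤ b ∧
        I ∈ {I | I.scopes f₀ ⊆ M ∧ weight t I.scopes M ≤ t}} := by
    intro I hI
    simp only [Set.mem_ofPred_eq, IsIsolated, not_forall, not_le] at hI
    obtain ⟨M, hf₀, hMb, hMw⟩ := hI
    have hcard : 0 < #(I.scopes f₀) := hk.trans_eq (Constraint.card_scope (I f₀)).symm
    exact ⟨M, (card_pos.1 hcard).mono hf₀, hMb, hf₀, Int.lt_add_one_iff.1 hMw⟩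
  refine (measureReal_mono hsub).trans (measureReal_exists_small_le (by positivity) ?_)
  intro M hM hMb
  have hu := hgain _ hM.card_pos hMb
  have hsqrt : Real.exp (Real.log n / 2) = √n := by
    rw [← Real.log_sqrt (Nat.cast_nonneg n), Real.exp_log (by positivity)]
  rw [Fintype.card_fin]
  calc n.choose #M * (randomInstance n m k L).real _
      ≤ Real.exp (#M * (2 * logRatio n #M - 4)) *
          Real.exp (k * (6 - 2 * logRatio n #M) + #M -
            (logGain k t n Δ #M + logRatio n #M * (2 * (#M - k) + 1))) := by
        gcongr
        · exact choose_le_exp hn hM.card_pos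
        · exact randomInstance_real_scope_subset_le h (by omega) hΔ hm hM
            (le_trans (by positivity) hu) f₀
    _ ≤ Real.exp (-Real.log (2 / β) + -(Real.log n / 2) + -#M) := by
        rw [← Real.exp_add, Real.exp_le_exp]
        linarith [neg_logRatio_le (n := n) hM.card_pos]
    _ = β / 2 / √n * Real.exp (-#M) := by
        rw [Real.exp_add, Real.exp_add, Real.exp_neg (Real.log (2 / β)),
          Real.exp_log (by positivity), inv_div, Real.exp_neg (Real.log n / 2), hsqrt,
          ← div_eq_mul_inv]

end UnionBound

/-! ### Choice of parameters -/

section Parameters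

variable {k t n : ℕ} {Δ β : ℝ}

lemma inv_sqrt_le_slack (hΔ : 10 ≤ Δ) : 1 / √(n : ℝ) ≤ slack n Δ :=
  div_le_div_of_nonneg_right (Real.one_le_rpow one_le_two (div_nonneg (Real.log_natCast_nonneg n)
    (by linarith [one_le_log hΔ]))) (Real.sqrt_nonneg _)

lemma two_mul_le_of_le_sosDegree (hk : 0 < k) (ht : 1 < t) (htk : t ≤ k) (hΔ : 10 ≤ Δ)
    (hβ : 0 < β) (hβ1 : β < 1) (h : (k : ℝ) ≤ sosDegree 100 β k t n Δ) : 2 * k ≤ n := by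
  have hk' : (1 : ℝ) ≤ k := Nat.one_le_cast.2 hk
  have ht' : (2 : ℝ) ≤ t := by exact_mod_cast ht
  have htk' : (t : ℝ) ≤ k := Nat.cast_le.2 htk
  have hβpow : β ^ (100 / (t : ℝ)) ≤ 1 := Real.rpow_le_one hβ.le hβ1.le (by positivity)
  have htwo : (2 : ℝ) ≤ 2 ^ (100 * (k : ℝ) / t) :=
    Real.self_le_rpow_of_one_le one_le_two (by rw [le_div_iff₀ (by linarith)]; linarith)
  have hΔpow : 1 ≤ Δ ^ (2 / ((t : ℝ) - 1)) :=
    Real.one_le_rpow (by linarith) (div_nonneg zero_le_two (by linarith))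
  have hden : 1 ≤ Δ ^ (2 / ((t : ℝ) - 1)) * Real.log Δ :=
    one_le_mul_of_one_le_of_one_le hΔpow (one_le_log hΔ)
  have hdegree : sosDegree 100 β k t n Δ ≤ 1 / (k * 2) * (n / 1) := by
    unfold sosDegree
    gcongr
  have hkn : (k : ℝ) * (k * 2) ≤ n := by
    rw [← le_div_iff₀ (by positivity)]
    exact h.trans (hdegree.trans_eq (by ring))
  have hkn' : (2 * k : ℝ) ≤ n := by nlinarith
  exact_mod_cast hkn'

lemma eighty_le_exp_five : (80 : ℝ) ≤ Real.exp 5 := by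
  calc (80 : ℝ) ≤ 2.7 ^ 5 := by norm_num
    _ ≤ Real.exp 1 ^ 5 := by
        gcongr
        linarith [Real.exp_one_gt_d9]
    _ = Real.exp 5 := by
        rw [← Real.exp_nat_mul]
        norm_num

lemma le_two_mul_logRatio (hk : 0 < k) (hn : 0 < n) (hΔ : 10 ≤ Δ) (hβ : 0 < β) {v : ℕ}
    (hv : 0 < v) (hvD : (v : ℝ) ≤ 80 * k * Real.log Δ * sosDegree 100 β k t n Δ) :
    100 / t * (k * Real.log 2 - Real.log β) + 2 / ((t : ℝ) - 1) * Real.log Δ ≤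
      2 * logRatio n v := by
  have hn' : (0 : ℝ) < n := Nat.cast_pos.2 hn
  have hΔ₀ : 0 < Δ := by linarith
  have hlog : 0 < Real.log Δ := by linarith [one_le_log hΔ]
  set x := 5 + 100 / t * Real.log β - 100 * k / t * Real.log 2 + Real.log n
    - 2 / ((t : ℝ) - 1) * Real.log Δ with hx
  have hexp : Real.exp x = Real.exp 5 * β ^ (100 / (t : ℝ)) / 2 ^ (100 * (k : ℝ) / t) * n
      / Δ ^ (2 / ((t : ℝ) - 1)) := by
    rw [hx, Real.exp_sub, Real.exp_add, Real.exp_sub, Real.exp_add, Real.exp_log hn',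
      Real.rpow_def_of_pos hβ, Real.rpow_def_of_pos two_pos, Real.rpow_def_of_pos hΔ₀]
    simp only [mul_comm (Real.log _)]
  have hv' : (v : ℝ) ≤ Real.exp x := by
    calc (v : ℝ) ≤ 80 * k * Real.log Δ * sosDegree 100 β k t n Δ := hvD
      _ = 80 * β ^ (100 / (t : ℝ)) / 2 ^ (100 * (k : ℝ) / t) * n
          / Δ ^ (2 / ((t : ℝ) - 1)) := by
          unfold sosDegree
          field_simp
      _ ≤ Real.exp x := by
          rw [hexp]
          gcongr
          exact eighty_le_exp_five
  have hlogv := (Real.log_le_iff_le_exp (Nat.cast_pos.2 hv)).2 hv'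
  have hsplit : 100 / t * (k * Real.log 2 - Real.log β) =
      100 * k / t * Real.log 2 - 100 / t * Real.log β := by ring
  unfold logRatio
  linarith

lemma le_logGain (hk : 0 < k) (ht : 1 < t) (hn : 0 < n) (hΔ : 10 ≤ Δ)
    (hβ : 0 < β) (hβ1 : β < 1) {v : ℕ} (hv : 0 < v)
    (hvD : (v : ℝ) ≤ 80 * k * Real.log Δ * sosDegree 100 β k t n Δ) :
    6 * k + 2 * Real.log (2 / β) ≤ logGain k t n Δ v := by
  have hk' : (1 : ℝ) ≤ k := Nat.one_le_cast.2 hk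
  have ht' : (2 : ℝ) ≤ t := by exact_mod_cast ht
  have hlog2 := Real.log_two_gt_d9
  set s := k * Real.log 2 - Real.log β
  have hlogβ : 0 < -Real.log β := neg_pos.2 (Real.log_neg hβ hβ1)
  have hs₀ : 0 ≤ s := by nlinarith
  have hratio : 50 * s + 2 * Real.log Δ ≤ 2 * ((t - 1) * logRatio n v) := by
    calc 50 * s + 2 * Real.log Δ
        ≤ 100 * (t - 1) / t * s + 2 * Real.log Δ := by
          gcongr
          rw [le_div_iff₀ (by linarith)]
          linarith
      _ = (t - 1) * (100 / t * s + 2 / ((t : ℝ) - 1) * Real.log Δ) := by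
          have ht₀ : (t : ℝ) - 1 ≠ 0 := by linarith
          field_simp
      _ ≤ (t - 1) * (2 * logRatio n v) :=
          mul_le_mul_of_nonneg_left (le_two_mul_logRatio hk hn hΔ hβ hv hvD) (by linarith)
      _ = 2 * ((t - 1) * logRatio n v) := by ring
  rw [Real.log_div two_ne_zero hβ.ne']
  unfold logGain
  have hfourteen : 14 * (k : ℝ) ≤ 25 * (k * Real.log 2) := by nlinarith
  linarith [Real.log_two_lt_d9]

lemma exists_set_size (hk : 0 < k) (hΔ : 10 ≤ Δ) {D : ℕ} (hD : 0 < D) :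
    ∃ b : ℕ, 4 * (D : ℝ) ≤ expansionRate k Δ * b ∧ (b : ℝ) ≤ 80 * k * Real.log Δ * D := by
  have hten := ten_le_inv_expansionRate hk hΔ
  have hD' : (1 : ℝ) ≤ D := Nat.one_le_cast.2 hD
  refine ⟨⌈10 * k * Real.log Δ * (4 * D)⌉₊, ?_, ?_⟩
  · rw [expansionRate, one_div, le_inv_mul_iff₀ (by linarith)]
    exact Nat.le_ceil _
  · refine (Nat.ceil_le_two_mul (by nlinarith)).trans_eq ?_
    ring

end Parameters

/-! ### Failure of refutation -/

section Refutation

lemma mul_measureReal_le_card_le {A ι : Type*} [MeasurableSpace A] {μ : Measure A}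
    [IsFiniteMeasure μ] [Fintype ι] {E : ι → Set A} [∀ x, DecidablePred (x ∈ E ·)]
    (hE : ∀ i, MeasurableSet (E i)) {p : ℝ} (hp : ∀ i, μ.real (E i) ≤ p) (a : ℝ) :
    a * μ.real {x | a ≤ #{i | x ∈ E i}} ≤ Fintype.card ι * p := by
  have hcard (x : A) : (#{i | x ∈ E i} : ℝ) = ∑ i, (E i).indicator 1 x := by
    simp only [Set.indicator_apply, Pi.one_apply, sum_boole]
  have hintegrable (i : ι) : Integrable ((E i).indicator (1 : A → ℝ)) μ :=
    (integrable_const 1).indicator (hE i)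
  simp only [hcard]
  calc a * μ.real {x | a ≤ ∑ i, (E i).indicator 1 x}
      ≤ ∫ x, ∑ i, (E i).indicator 1 x ∂μ :=
        mul_meas_ge_le_integral_of_nonneg
          (ae_of_all _ fun x => sum_nonneg fun i _ => Set.indicator_nonneg (by simp) x)
          (integrable_finsetSum _ fun i _ => hintegrable i) a
    _ = ∑ i, μ.real (E i) := by
        rw [integral_finsetSum _ fun i _ => hintegrable i]
        exact sum_congr rfl fun i _ => integral_indicator_one (hE i)
    _ ≤ Fintype.card ι * p := by
        rw [← nsmul_eq_mul]
        exact sum_le_card_nsmul _ _ _ fun i _ => hp i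

variable {n m k t b : ℕ} {Ω : Type*} {L : Finset (Equiv.Perm Ω)} {Δ β ε : ℝ}

open Classical in
lemma randomInstance_real_le_card_not_isIsolated_le (hk : 0 < k) (htk : t ≤ k) (h : 2 * k ≤ n)
    (hΔ : 0 < Δ) (hm : (m : ℝ) = Δ * n) (hβ : 0 < β) (hβ1 : β < 1)
    (hgain : ∀ v, 0 < v → v ≤ b → 6 * k + 2 * Real.log (2 / β) ≤ logGain k t n Δ v)
    (hε : 1 / √(n : ℝ) ≤ ε) :
    (randomInstance n m k L).real {I | ε * m ≤ #{f | ¬ IsIsolated t I.scopes b f}} ≤ β / 2 := by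
  have hn : (0 : ℝ) < n := Nat.cast_pos.2 (by omega)
  have hm' : (0 : ℝ) < m := hm ▸ mul_pos hΔ hn
  have hmarkov := mul_measureReal_le_card_le (μ := randomInstance n m k L)
    (E := fun f => {I | ¬ IsIsolated t I.scopes b f}) (fun _ => trivial)
    (randomInstance_real_not_isIsolated_le hk htk h hΔ hm hβ hβ1 hgain) (ε * m)
  rw [Fintype.card_fin] at hmarkov
  refine le_of_mul_le_mul_left ?_ (by positivity : 0 < 1 / √(n : ℝ) * m)
  calc 1 / √(n : ℝ) * m * (randomInstance n m k L).real
        {I | ε * m ≤ #{f | ¬ IsIsolated t I.scopes b f}}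
      ≤ ε * m * (randomInstance n m k L).real
        {I | ε * m ≤ #{f | ¬ IsIsolated t I.scopes b f}} := by gcongr
    _ ≤ m * (β / 2 / √n) := hmarkov
    _ = 1 / √(n : ℝ) * m * (β / 2) := by ring

variable [Fintype Ω] [DecidableEq Ω] [Nonempty Ω] {P : (Fin k → Ω) → Bool}

open Classical in
lemma randomInstance_real_sosRefutes_le {D : ℕ} (ht : 1 < t) (htk : t ≤ k) (hP : ∃ x, P x = true)
    (h : 2 * k ≤ n) (hΔ : 10 ≤ Δ) (hm : (m : ℝ) = Δ * n) (hβ : 0 < β) (hβ1 : β < 1)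
    (hgain : ∀ v, 0 < v → v ≤ b → 6 * k + 2 * Real.log (2 / β) ≤ logGain k t n Δ v)
    (hε : 1 / √(n : ℝ) ≤ ε) (hD : 4 * (D : ℝ) ≤ expansionRate k Δ * b) (hkD : k ≤ D) :
    (randomInstance n m k L).real {I | SOSRefutes D P (deltaP P t + ε) I} ≤ β := by
  have hk : 0 < k := by omega
  have hΔ₀ : 0 < Δ := by linarith
  have hn : 0 < n := by omega
  have hm₀ : 0 < m := Nat.cast_pos.1 (hm ▸ mul_pos hΔ₀ (Nat.cast_pos.2 hn))
  have hsub : {I : CSPInstance n m k L | SOSRefutes D P (deltaP P t + ε) I} ⊆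
      {I | ¬ IsExpanding t I.scopes (expansionRate k Δ) b} ∪
        {I | ε * m ≤ #{f | ¬ IsIsolated t I.scopes b f}} := by
    intro I hI
    by_contra hgood
    simp only [Set.mem_union, Set.mem_ofPred_eq, not_or, not_not, not_le] at hgood
    obtain ⟨hexp, hisolated⟩ := hgood
    refine not_sosRefutes_of_isExpanding (G := {f | IsIsolated t I.scopes b f}) ht.le htk hP hm₀
      hexp (expansionRate_pos hk hΔ) (expansionRate_le_one hk hΔ) hD hkD
      (fun f hf => (mem_filter.1 hf).2) ?_ hI
    have hsplit := card_filter_add_card_filter_not (s := univ) (IsIsolated t I.scopes b)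
    rw [card_univ, Fintype.card_fin] at hsplit
    have hsplit' : (#{f | IsIsolated t I.scopes b f} : ℝ) + #{f | ¬ IsIsolated t I.scopes b f}
        = m := by exact_mod_cast hsplit
    linarith
  linarith [measureReal_mono (μ := randomInstance n m k L) hsub,
    measureReal_union_le (μ := randomInstance n m k L)
      {I | ¬ IsExpanding t I.scopes (expansionRate k Δ) b}
      {I | ε * m ≤ #{f | ¬ IsIsolated t I.scopes b f}},
    randomInstance_real_not_isExpanding_le (L := L) hk ht h hΔ hm hβ hβ1 hgain,
    randomInstance_real_le_card_not_isIsolated_le (L := L) hk htk h hΔ₀ hm hβ hβ1 hgain hε]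

theorem randomInstance_sosRefutes_slack_le (ht : 1 < t) (htk : t ≤ k) (hP : ∃ x, P x = true)
    (hn : 0 < n) (hΔ : 10 ≤ Δ) (hm : (m : ℝ) = Δ * n) (hβ : 0 < β) (hβ1 : β < 1) :
    randomInstance n m k L
        {I | SOSRefutes ⌊sosDegree 100 β k t n Δ⌋₊ P (deltaP P t + slack n Δ) I}
      ≤ ENNReal.ofReal β := by
  have hk : 0 < k := by omega
  rw [← ofReal_measureReal]
  refine ENNReal.ofReal_le_ofReal ?_
  rcases lt_or_ge ⌊sosDegree 100 β k t n Δ⌋₊ k with hDk | hkD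
  · have hm₀ : 0 < m :=
      Nat.cast_pos.1 (hm ▸ mul_pos (by linarith) (Nat.cast_pos.2 hn))
    simp [not_sosRefutes_of_lt hP hm₀ hDk, hβ.le]
  · have hdegree : (⌊sosDegree 100 β k t n Δ⌋₊ : ℝ) ≤ sosDegree 100 β k t n Δ :=
      Nat.floor_le (zero_le_one.trans (Nat.floor_pos.1 (hk.trans_le hkD)))
    obtain ⟨b, hDb, hb⟩ := exists_set_size hk hΔ (hk.trans_le hkD)
    have hlog := one_le_log hΔ
    have hgain (v : ℕ) (hv : 0 < v) (hvb : v ≤ b) :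
        6 * k + 2 * Real.log (2 / β) ≤ logGain k t n Δ v :=
      le_logGain hk ht hn hΔ hβ hβ1 hv ((Nat.cast_le.2 hvb).trans (hb.trans (by gcongr)))
    exact randomInstance_real_sosRefutes_le ht htk hP
      (two_mul_le_of_le_sosDegree hk ht htk hΔ hβ hβ1 ((Nat.cast_le.2 hkD).trans hdegree))
      hΔ hm hβ hβ1 hgain (inv_sqrt_le_slack hΔ) hDb hkD

end Refutation

/-! ### Asymptotics of the slack -/

section Slack

lemma slack_le {n : ℕ} {Δ c : ℝ} (h : Real.log n / (2 * Real.log Δ) ≤ c) :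
    slack n Δ ≤ 2 ^ c * (1 / √(n : ℝ)) := by
  rw [slack, mul_one_div]
  gcongr
  exact one_le_two

lemma slack_nonneg (n : ℕ) (Δ : ℝ) : 0 ≤ slack n Δ := by
  unfold slack
  positivity

lemma slack_le_rpow_neg {n : ℕ} {Δ : ℝ} (hn : 0 < n) (hΔ : 10 ≤ Δ) :
    slack n Δ ≤ (n : ℝ) ^ (-(1 / 4) : ℝ) := by
  have hn' : (0 : ℝ) < n := Nat.cast_pos.2 hn
  have hlogn : 0 ≤ Real.log n := Real.log_natCast_nonneg n
  have hlog : 2 ≤ Real.log Δ := by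
    have hexp : Real.exp 2 = Real.exp 1 ^ 2 := by
      rw [← Real.exp_nat_mul]
      norm_num
    rw [Real.le_log_iff_exp_le (by linarith), hexp]
    nlinarith [Real.exp_one_lt_d9, Real.exp_pos 1]
  have hquarter : Real.log n / (2 * Real.log Δ) ≤ Real.log n / 4 :=
    div_le_div_of_nonneg_left hlogn four_pos (by linarith)
  refine (slack_le hquarter).trans ?_
  rw [Real.sqrt_eq_rpow, one_div, ← Real.rpow_neg hn'.le, Real.rpow_def_of_pos two_pos,
    Real.rpow_def_of_pos hn', Real.rpow_def_of_pos hn', ← Real.exp_add, Real.exp_le_exp]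
  nlinarith [Real.log_two_lt_d9]

lemma tendsto_slack {Δ : ℕ → ℝ} (hΔ : ∀ᶠ n in atTop, 10 ≤ Δ n) :
    Tendsto (fun n => slack n (Δ n)) atTop (𝓝 0) := by
  have hlim : Tendsto (fun n : ℕ => (n : ℝ) ^ (-(1 / 4) : ℝ)) atTop (𝓝 0) :=
    (tendsto_rpow_neg_atTop (by norm_num)).comp tendsto_natCast_atTop_atTop
  refine tendsto_of_tendsto_of_tendsto_of_le_of_le' tendsto_const_nhds hlim
    (Eventually.of_forall fun n => slack_nonneg n _) ?_
  filter_upwards [hΔ, eventually_gt_atTop 0] with n hΔn hn using slack_le_rpow_neg hn hΔn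

lemma slack_isBigO {Δ : ℕ → ℝ} (hΔ : ∃ c : ℝ, 0 < c ∧ ∀ᶠ n : ℕ in atTop, (n : ℝ) ^ c ≤ Δ n) :
    (fun n => slack n (Δ n)) =O[atTop] fun n : ℕ => 1 / √(n : ℝ) := by
  obtain ⟨c, hc, hΔ⟩ := hΔ
  refine IsBigO.of_bound (2 ^ (1 / (2 * c))) ?_
  filter_upwards [hΔ, eventually_gt_atTop 1] with n hΔn hn
  have hn' : (1 : ℝ) < n := Nat.one_lt_cast.2 hn
  have hlog : c * Real.log n ≤ Real.log (Δ n) := by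
    rw [← Real.log_rpow (by linarith)]
    exact Real.log_le_log (by positivity) hΔn
  have hpos : 0 < c * Real.log n := mul_pos hc (Real.log_pos hn')
  rw [Real.norm_of_nonneg (slack_nonneg _ _), Real.norm_of_nonneg (by positivity)]
  refine slack_le ?_
  rw [div_le_div_iff₀ (by linarith) (by linarith)]
  linarith

end Slack

end RandomCSP

end

theorem theorem8p2 :
    (∃ C : ℝ, 0 < C ∧
      ∀ (Ω : Type) [Fintype Ω] [DecidableEq Ω] (_ : 2 ≤ Fintype.card Ω)
        (L : Finset (Equiv.Perm Ω)) (_ : L.Nonempty)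
        (k t : ℕ) (_ : 1 < t) (_ : t ≤ k)
        (P : (Fin k → Ω) → Bool) (_ : ∃ x, P x = true)
        (n m : ℕ) (_ : 0 < n) (Δ : ℝ) (_ : 10 ≤ Δ) (_ : (m : ℝ) = Δ * n)
        (β : ℝ) (_ : 0 < β) (_ : β < 1),
        RandomCSP.randomInstance n m k L
            {I | RandomCSP.SOSRefutes ⌊RandomCSP.sosDegree C β k t n Δ⌋₊ P
              (RandomCSP.deltaP P t + RandomCSP.slack n Δ) I}
          ≤ ENNReal.ofReal β) ∧
    (∀ Δ : ℕ → ℝ, (∀ᶠ n in atTop, 10 ≤ Δ n) →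
      Tendsto (fun n => RandomCSP.slack n (Δ n)) atTop (𝓝 0)) ∧
    (∀ Δ : ℕ → ℝ, (∃ c : ℝ, 0 < c ∧ ∀ᶠ n : ℕ in atTop, (n : ℝ) ^ c ≤ Δ n) →
      (fun n => RandomCSP.slack n (Δ n)) =O[atTop] fun n : ℕ => 1 / √(n : ℝ)) := by
  refine ⟨⟨100, by norm_num, ?_⟩, fun Δ hΔ => RandomCSP.tendsto_slack hΔ,
    fun Δ hΔ => RandomCSP.slack_isBigO hΔ⟩
  intro Ω _ _ hΩ L _ k t ht htk P hP n m hn Δ hΔ hm β hβ hβ1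
  have : Nonempty Ω := Fintype.card_pos_iff.1 (by omega)
  exact RandomCSP.randomInstance_sosRefutes_slack_le ht htk hP hn hΔ hm hβ hβ1
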